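/- Let $K$ be a field, $S=K[x_1,\dots,x_n]$, $d\ge 1$ and $1\le k\le n-1$. Let $\alpha_1,\dots,\alpha_n$, $\beta_1,\dots,\beta_n$, $b_1,\dots,b_n$ be non-negative integers such that $\alpha_1\le\dots\le\alpha_n=d$, $\beta_1\le\dots\le\beta_n=d$, $\alpha_i\le\beta_i$ for all $i$; $b_i\ge d$ and $\beta_i>0$ for $i\le k$; $b_i>0$ for $i>k$; and $\alpha_i=\alpha_k$, $\beta_i=d$ for $k+1\le i\le n-1$. Put $b([k+1,n])=b_{k+1}+\dots+b_n$ and assume $d\le\beta_k+b([k+1,n])$. Let $I\subset S$ be the right PLP-polymatroidal ideal with these data, i.e. the ideal generated by all monomials $x_1^{u_1}\cdots x_n^{u_n}$ with $0\le u_i\le b_i$ and $\alpha_i\le u_1+\dots+u_i\le\beta_i$ for $i=1,\dots,n$. Let $\mathrm{astab}(I)$ (resp. $\mathrm{dstab}(I)$) be the smallest integer $m\ge1$ such that $\mathrm{Ass}(S/I^m)=\mathrm{Ass}(S/I^\ell)$ (resp. $\mathrm{depth}\,S/I^m=\mathrm{depth}\,S/I^\ell$) for all $\ell\ge m$, where depth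 is taken with respect to $(x_1,\dots,x_n)$. Then: (a) If $d=\beta_k+b([k+1,n])$, then $\mathrm{astab}(I)=1$. (b) If $d<\beta_k+b([k+1,n])$, then $$\mathrm{astab}(I)=\max\left\{1,\left\lceil\frac{n-k-\lfloor\alpha_k/\beta_k\rfloor}{\beta_k+b([k+1,n])-d}\right\rceil\right\}.$$ (The maximum with $1$ matters only when $k=n-1$ and $\alpha_k=\beta_k$, where the fraction is $0$.) (c) In both cases $\mathrm{astab}(I)=\mathrm{dstab}(I)$. -/

import Mathlib

noncomputable section

/-- The standing conditions on the bounds `α`, `β` of a PLP-polymatroid of rank `d` on `n` elements: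
`α_1 ≤ ⋯ ≤ α_n = d`, `β_1 ≤ ⋯ ≤ β_n = d` and `α_i ≤ β_i`. Index conventions: `Fin n` is 0-based, so the usual 1-based index `i` is the element of
`Fin n` with value `i - 1`; the initial sum `u_1 + ⋯ + u_i` is the sum over `Finset.Iic i`, and the
interval `[k+1, n]` is `Finset.Ioi k`. -/
structure IsPLPType (n d : ℕ) (α β : Fin n → ℕ) : Prop where
  n_pos : 0 < n
  d_pos : 0 < d
  monotone_α : Monotone α
  monotone_β : Monotone β
  α_last : ∀ i : Fin n, (i : ℕ) + 1 = n → α i = d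
  β_last : ∀ i : Fin n, (i : ℕ) + 1 = n → β i = d
  α_le_β : ∀ i, α i ≤ β i

/-- The set of bases of the pruned lattice path polymatroid of type `(a, b | α, β)`. -/
def plpBases {n : ℕ} (a b α β : Fin n → ℕ) : Set (Fin n →₀ ℕ) :=
  {u | (∀ i, a i ≤ u i ∧ u i ≤ b i) ∧
    ∀ i, α i ≤ ∑ j ∈ Finset.Iic i, u j ∧ ∑ j ∈ Finset.Iic i, u j ≤ β i}

/-- The PLP-polymatroidal ideal of type `(a, b | α, β)` in `K[x_1, …, x_n]`, generated by the
monomials whose exponent vectors are the bases. -/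
def plpIdeal (K : Type*) [Field K] {n : ℕ} (a b α β : Fin n → ℕ) :
    Ideal (MvPolynomial (Fin n) K) :=
  Ideal.span ((fun u : Fin n →₀ ℕ => MvPolynomial.monomial u (1 : K)) '' plpBases a b α β)

/-- The numerical data `(0, b | α, β)` of a right PLP-polymatroidal ideal of degree `d`, with
distinguished index `k < n` (`k` is not the last element of `Fin n`). -/
structure IsRightPLPType (n d : ℕ) (k : Fin n) (b α β : Fin n → ℕ) : Prop
    extends IsPLPType n d α β where
  k_lt : (k : ℕ) + 1 < n
  le_b : ∀ i, i ≤ k → d ≤ b i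
  α_right : ∀ i : Fin n, k < i → (i : ℕ) + 1 < n → α i = α k
  β_right : ∀ i : Fin n, k < i → (i : ℕ) + 1 < n → β i = d
  β_pos : ∀ i, i ≤ k → 0 < β i
  b_pos : ∀ i, k < i → 0 < b i
  d_le : d ≤ β k + ∑ i ∈ Finset.Ioi k, b i

/-- `I` is the right PLP-polymatroidal ideal of type `(0, b | α, β)`. -/
structure IsRightPLPIdeal {K : Type*} [Field K] {n : ℕ} (I : Ideal (MvPolynomial (Fin n) K))
    (d : ℕ) (k : Fin n) (b α β : Fin n → ℕ) : Prop where
  type : IsRightPLPType n d k b α β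
  eq : I = plpIdeal K 0 b α β

/-- The depth of the quotient `S / I` of `S = K[x_1, …, x_n]`: the supremum of the lengths of
`S / I`-regular sequences contained in the graded maximal ideal `(x_1, …, x_n)`. -/
def depthQuot {K : Type*} [Field K] {n : ℕ} (I : Ideal (MvPolynomial (Fin n) K)) : ℕ∞ :=
  ⨆ rs ∈ {rs : List (MvPolynomial (Fin n) K) |
      (∀ r ∈ rs, r ∈ Ideal.span (Set.range (MvPolynomial.X (R := K) (σ := Fin n)))) ∧
      RingTheory.Sequence.IsRegular (MvPolynomial (Fin n) K ⧸ I) rs},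
    (rs.length : ℕ∞)

/-- The smallest positive integer from which on `Ass (S / I ^ m)` is constant
(`0` if there is none). -/
def astab {K : Type*} [Field K] {n : ℕ} (I : Ideal (MvPolynomial (Fin n) K)) : ℕ :=
  sInf {m : ℕ | 1 ≤ m ∧ ∀ l, m ≤ l →
    associatedPrimes (MvPolynomial (Fin n) K) (MvPolynomial (Fin n) K ⧸ I ^ m) =
      associatedPrimes (MvPolynomial (Fin n) K) (MvPolynomial (Fin n) K ⧸ I ^ l)}

/-- The smallest positive integer from which on `depth (S / I ^ m)` is constant
(`0` if there is none). -/
def dstab {K : Type*} [Field K] {n : ℕ} (I : Ideal (MvPolynomial (Fin n) K)) : ℕ :=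
  sInf {m : ℕ | 1 ≤ m ∧ ∀ l, m ≤ l → depthQuot (I ^ m) = depthQuot (I ^ l)}

end

/-! Put e = β_k + b([k+1,n]) − d, and let τ (`threshold`) be n − k or n − k − 1 according to whether
α_k < β_k or α_k = β_k, where α_k is first raised to max(α_k, d − b([k+1,n])), which changes no
base. For e > 0 this τ is the numerator n − k − ⌊α_k/β_k⌋. Both invariants of I^m turn out to depend
on m only through the comparison of m·e with τ.

Powers. Partial sums of a base of the scaled data split by integer division, so I^m is the ideal of
the same kind with all data multiplied by m (`spanMon_pow`), and e becomes m·e. It remains to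
compute Ass and depth of one such ideal from its data.

Associated primes. A prime associated to a monomial ideal is generated by variables and annihilates
a monomial w whose exponents outside the prime may be taken arbitrarily large
(`mem_associatedPrimes_iff`). Lying above a base is equivalent to a system of interval inequalities
(`above_iff`), obtained from a greedy choice. Since w violates one of them and raising any variable
of the prime repairs it, the prime is read off from the violated inequality. This gives the two
families of `isSocle_iff`. `LeftType` is invariant under scaling. `RightType` consists of an
interval ending at κ together with a set T of right variables, and only its bounds on |T| change
with m: |T| ≤ m·e if the interval is nonempty, and |T| ≤ m·e + 1 always.

Depth. It equals n minus the top degree of nonvanishing Koszul homology (`depthQuot_eq`).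
Lexicographic linear quotients bound this degree from above (`van_of_data`). Explicit chains, built
one variable at a time, have a nonzero boundary with coefficients supported on bases and so give
classes in exactly that degree (`not_van_of_data`). For I^m the degree is a constant plus min(τ,
m·e), apart from the case α_k = β_k = d, where it does not depend on m (`depthQuot_pow`).

Hence both sequences are stable from m on exactly when e = 0 or τ ≤ m·e, and `sInf_stable_eq` turns
this into the same formula for both indices. -/

/-! ### The Koszul complex of a sequence of ring elements with coefficients in a module -/

namespace Koszul

open Finset
open scoped Pointwise

variable {n : ℕ} {R : Type*} [CommRing R]
variable {M : Type*} [AddCommGroup M] [Module R M]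
variable {N : Type*} [AddCommGroup N] [Module R N]

/-- The sign of moving the index `l` past the smaller elements of `A`. -/
def sgn (l : Fin n) (A : Finset (Fin n)) : ℤ := (-1) ^ (A.filter (· < l)).card

/-- Contraction with the `l`-th dual basis vector. -/
def contr (l : Fin n) (z : Finset (Fin n) → M) : Finset (Fin n) → M :=
  fun A => if l ∈ A then 0 else sgn l A • z (insert l A)

/-- Exterior multiplication by the `l`-th basis vector. -/
def wedge (l : Fin n) (z : Finset (Fin n) → M) : Finset (Fin n) → M :=
  fun A => if l ∈ A then sgn l A • z (A.erase l) else 0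

/-- The Koszul differential. -/
def diff (x : Fin n → R) (z : Finset (Fin n) → M) : Finset (Fin n) → M :=
  fun A => ∑ l, x l • contr l z A

/-- The chain `z` is concentrated in homological degree `i`. -/
def Supp (z : Finset (Fin n) → M) (i : ℕ) : Prop := ∀ A, A.card ≠ i → z A = 0

/-- The Koszul homology of `M` vanishes in degree `i`. -/
def Van (x : Fin n → R) (M : Type*) [AddCommGroup M] [Module R M] (i : ℕ) : Prop :=
  ∀ z : Finset (Fin n) → M, Supp z i → diff x z = 0 → ∃ y, Supp y (i + 1) ∧ diff x y = z

lemma sgn_insert {l m : Fin n} {A : Finset (Fin n)} (hm : m ∉ A) :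
    sgn l (insert m A) = (if m < l then -1 else 1) * sgn l A := by
  unfold sgn
  rw [filter_insert]
  split_ifs with h
  · rw [card_insert_of_notMem (by simp [hm]), pow_succ]; ring
  · simp

lemma sgn_mul_self (l : Fin n) (A : Finset (Fin n)) : sgn l A * sgn l A = 1 := by
  unfold sgn
  rw [← mul_pow]; norm_num

lemma sgn_smul_eq_zero {l : Fin n} {A : Finset (Fin n)} {v : M} : sgn l A • v = 0 ↔ v = 0 := by
  refine ⟨fun h => ?_, fun h => by simp [h]⟩
  have : sgn l A • (sgn l A • v) = 0 := by rw [h, smul_zero]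
  rwa [smul_smul, sgn_mul_self, one_smul] at this

lemma contr_contr (l m : Fin n) (z : Finset (Fin n) → M) (A : Finset (Fin n)) :
    contr l (contr m z) A + contr m (contr l z) A = 0 := by
  by_cases hlm : l = m
  · subst hlm
    simp [contr]
  by_cases hl : l ∈ A
  · simp [contr, hl]
  by_cases hm : m ∈ A
  · simp [contr, hm]
  have h1 : m ∉ insert l A := by simp [hm, Ne.symm hlm]
  have h2 : l ∉ insert m A := by simp [hl, hlm]
  simp only [contr, hl, hm, h1, h2, if_false, smul_smul]
  rw [Finset.insert_comm, ← add_smul, sgn_insert hl, sgn_insert hm]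
  rcases lt_or_gt_of_ne hlm with h | h
  · rw [if_pos h, if_neg h.not_gt]; convert! zero_smul ℤ _; ring
  · rw [if_pos h, if_neg h.not_gt]; convert! zero_smul ℤ _; ring

lemma contr_wedge_of_ne {l m : Fin n} (hlm : l ≠ m) (z : Finset (Fin n) → M)
    (A : Finset (Fin n)) : contr l (wedge m z) A + wedge m (contr l z) A = 0 := by
  by_cases hl : l ∈ A
  · by_cases hm : m ∈ A <;> simp [contr, wedge, hl, hm, hlm]
  by_cases hm : m ∈ A
  · obtain ⟨A', hmA, rfl⟩ : ∃ A', m ∉ A' ∧ A = insert m A' :=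
      ⟨A.erase m, by simp, by simp [hm]⟩
    have hl' : l ∉ A' := fun h => hl (by simp [h])
    have h1 : m ∉ insert l A' := by simp [hmA, Ne.symm hlm]
    have e1 : (insert l (insert m A')).erase m = insert l A' := by
      rw [Finset.insert_comm, erase_insert h1]
    simp only [contr, wedge, hl, if_false, mem_insert, true_or, or_true, if_true, e1,
      erase_insert hmA, hl', smul_smul]
    rw [← add_smul, sgn_insert hl, sgn_insert hmA]
    rcases lt_or_gt_of_ne hlm with h | h
    · rw [if_pos h, if_neg h.not_gt]; convert! zero_smul ℤ _; ring
    · rw [if_pos h, if_neg h.not_gt]; convert! zero_smul ℤ _; ring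
  · simp [contr, wedge, hl, hm, Ne.symm hlm]

lemma contr_wedge_self (l : Fin n) (z : Finset (Fin n) → M) (A : Finset (Fin n)) :
    contr l (wedge l z) A + wedge l (contr l z) A = z A := by
  have key : ∀ A' : Finset (Fin n), l ∉ A' → sgn l (insert l A') = sgn l A' := fun A' h => by
    rw [sgn_insert h]; simp
  by_cases hl : l ∈ A
  · obtain ⟨A', hA, rfl⟩ : ∃ A', l ∉ A' ∧ A = insert l A' :=
      ⟨A.erase l, by simp, by simp [hl]⟩
    simp [contr, wedge, hA, smul_smul, key A' hA, sgn_mul_self]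
  · simp [contr, wedge, hl, smul_smul, key A hl, sgn_mul_self]

lemma diff_add (x : Fin n → R) (y z : Finset (Fin n) → M) :
    diff x (y + z) = diff x y + diff x z := by
  funext A
  simp only [diff, Pi.add_apply, ← sum_add_distrib]
  refine sum_congr rfl fun l _ => ?_
  unfold contr; split_ifs <;> simp

lemma contr_smul (f : R) (l : Fin n) (z : Finset (Fin n) → M) :
    contr l (f • z) = f • contr l z := by
  funext A
  simp only [contr, Pi.smul_apply]
  split_ifs
  · simp
  · rw [smul_comm]

lemma diff_smul (x : Fin n → R) (f : R) (z : Finset (Fin n) → M) :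
    diff x (f • z) = f • diff x z := by
  funext A
  simp only [diff, contr_smul, Pi.smul_apply, smul_sum]
  exact sum_congr rfl fun l _ => smul_comm _ _ _

lemma diff_zero (x : Fin n → R) : diff x (0 : Finset (Fin n) → M) = 0 := by
  have := diff_smul x 0 (0 : Finset (Fin n) → M)
  simpa using this

lemma diff_neg (x : Fin n → R) (z : Finset (Fin n) → M) : diff x (-z) = -diff x z := by
  have := diff_smul x (-1) z
  simpa using this

lemma diff_sub (x : Fin n → R) (y z : Finset (Fin n) → M) :
    diff x (y - z) = diff x y - diff x z := by
  rw [sub_eq_add_neg, diff_add, diff_neg, sub_eq_add_neg]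

lemma diff_sum {ι : Type*} (x : Fin n → R) (s : Finset ι) (z : ι → Finset (Fin n) → M) :
    diff x (∑ i ∈ s, z i) = ∑ i ∈ s, diff x (z i) := by
  classical
  induction s using Finset.induction_on with
  | empty => simp [diff_zero]
  | insert a s ha ih => rw [sum_insert ha, sum_insert ha, diff_add, ih]

lemma diff_comp (x : Fin n → R) (φ : M →ₗ[R] N) (z : Finset (Fin n) → M) :
    diff x (fun A => φ (z A)) = fun A => φ (diff x z A) := by
  funext A
  simp only [diff, map_sum, map_smul]
  refine sum_congr rfl fun l _ => ?_
  unfold contr; split_ifs <;> simp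

lemma contr_diff (x : Fin n → R) (l : Fin n) (z : Finset (Fin n) → M) (A : Finset (Fin n)) :
    contr l (diff x z) A = ∑ m, x m • contr l (contr m z) A := by
  simp only [contr, diff]
  split_ifs with h
  · simp
  · rw [smul_sum]
    exact sum_congr rfl fun m _ => smul_comm _ _ _

lemma diff_diff (x : Fin n → R) (z : Finset (Fin n) → M) : diff x (diff x z) = 0 := by
  funext A
  have : diff x (diff x z) A =
      ∑ p : Fin n × Fin n, (x p.1 * x p.2) • contr p.1 (contr p.2 z) A := by
    rw [Fintype.sum_prod_type]
    simp only [diff, mul_smul, ← smul_sum]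
    refine sum_congr rfl fun l _ => ?_
    rw [← contr_diff]
  rw [this]
  refine sum_involution (fun p _ => (p.2, p.1)) ?_ ?_ (by simp) (by simp)
  · rintro ⟨l, m⟩ -
    simp only
    rw [mul_comm (x m), ← smul_add, contr_contr, smul_zero]
  · rintro ⟨l, m⟩ - h heq
    simp only [Prod.mk.injEq] at heq
    obtain ⟨rfl, -⟩ := heq
    apply h
    simp [contr]

lemma diff_wedge (x : Fin n → R) (l : Fin n) (z : Finset (Fin n) → M) :
    diff x (wedge l z) = x l • z - wedge l (diff x z) := by
  funext A
  have h1 : wedge l (diff x z) A = ∑ m, x m • wedge l (contr m z) A := by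
    simp only [wedge, diff]
    split_ifs with h
    · rw [smul_sum]
      exact sum_congr rfl fun m _ => smul_comm _ _ _
    · simp
  rw [Pi.sub_apply, eq_sub_iff_add_eq, h1, diff, ← sum_add_distrib]
  simp only [← smul_add]
  rw [sum_eq_single l, contr_wedge_self]; rfl
  · intro m _ hm
    rw [contr_wedge_of_ne hm, smul_zero]
  · simp

lemma Supp.diff {x : Fin n → R} {z : Finset (Fin n) → M} {i : ℕ} (h : Supp z (i + 1)) :
    Supp (diff x z) i := by
  intro A hA
  refine sum_eq_zero fun l _ => ?_
  unfold contr
  split_ifs with hl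
  · simp
  · rw [h, smul_zero, smul_zero]
    rw [card_insert_of_notMem hl]; omega

lemma Supp.wedge {z : Finset (Fin n) → M} {i : ℕ} (h : Supp z i) (l : Fin n) :
    Supp (wedge l z) (i + 1) := by
  intro A hA
  unfold Koszul.wedge
  split_ifs with hl
  · rw [h, smul_zero]
    have := card_pos.mpr ⟨l, hl⟩
    rw [card_erase_of_mem hl]; omega
  · rfl

lemma Supp.smul {z : Finset (Fin n) → M} {i : ℕ} (h : Supp z i) (f : R) : Supp (f • z) i :=
  fun A hA => by rw [Pi.smul_apply, h A hA, smul_zero]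

lemma Supp.sub {y z : Finset (Fin n) → M} {i : ℕ} (hy : Supp y i) (hz : Supp z i) :
    Supp (y - z) i :=
  fun A hA => by rw [Pi.sub_apply, hy A hA, hz A hA, sub_zero]

lemma Supp.comp {z : Finset (Fin n) → M} {i : ℕ} (h : Supp z i) (φ : M →ₗ[R] N) :
    Supp (fun A => φ (z A)) i :=
  fun A hA => by simp only [h A hA, map_zero]

lemma Supp.lift {φ : M →ₗ[R] N} (hφ : Function.Surjective φ) {z : Finset (Fin n) → N} {i : ℕ}
    (h : Supp z i) : ∃ y : Finset (Fin n) → M, Supp y i ∧ ∀ A, φ (y A) = z A := by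
  choose g hg using hφ
  refine ⟨fun A => if A.card = i then g (z A) else 0, fun A hA => if_neg hA, fun A => ?_⟩
  by_cases hA : A.card = i
  · simp [hA, hg]
  · simp [hA, h A hA]

/-- Multiplication by an element of the ideal generated by `x` is homotopic to zero. -/
lemma exists_homotopy {x : Fin n → R} {f : R} (hf : f ∈ Ideal.span (Set.range x))
    {z : Finset (Fin n) → M} {i : ℕ} (hz : Supp z i) (h0 : diff x z = 0) :
    ∃ y, Supp y (i + 1) ∧ diff x y = f • z := by
  obtain ⟨g, rfl⟩ := Ideal.mem_span_range_iff_exists_fun.mp hf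
  refine ⟨∑ l, g l • wedge l z, fun A hA => ?_, ?_⟩
  · rw [Finset.sum_apply]
    exact sum_eq_zero fun l _ => ((hz.wedge l).smul (g l)) A hA
  · rw [diff_sum, sum_smul]
    refine sum_congr rfl fun l _ => ?_
    rw [diff_smul, diff_wedge, h0, mul_smul]
    have : wedge l (0 : Finset (Fin n) → M) = 0 := by
      funext A; simp [wedge]
    rw [this, sub_zero]

/-- In the long exact sequence of multiplication by f, H_{i+1}(N) maps onto the kernel of f on
H_i(M), and that kernel is everything because f is null-homotopic. On chains: f z = ∂y, then y is
corrected by a boundary to a multiple of f, and f is cancelled. -/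
lemma Van.of_quotient {x : Fin n → R} {f : R} (hf : f ∈ Ideal.span (Set.range x))
    (hreg : IsSMulRegular M f) {π : M →ₗ[R] N} (hπ : Function.Surjective π)
    (hker : ∀ v, π v = 0 ↔ ∃ u, f • u = v) {i : ℕ} (h : Van x N (i + 1)) : Van x M i := by
  intro z hz h0
  obtain ⟨y, hy, hyz⟩ := exists_homotopy hf hz h0
  obtain ⟨y1, hy1, hy1'⟩ := h (fun A => π (y A)) (hy.comp π) (by
    rw [diff_comp, hyz]
    funext A
    exact (hker _).2 ⟨z A, rfl⟩)
  obtain ⟨y2, hy2, hy2'⟩ := hy1.lift hπ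
  have h3 : ∀ A, ∃ u, f • u = (y - diff x y2) A := fun A => by
    rw [← hker, Pi.sub_apply, map_sub]
    have e : (fun A => π (y2 A)) = y1 := funext hy2'
    have := congrFun (diff_comp x π y2) A
    rw [e, hy1'] at this
    rw [← this, sub_self]
  choose y3 hy3 using h3
  refine ⟨y3, fun A hA => hreg ?_, ?_⟩
  · simp only [hy3, (hy.sub hy2.diff) A hA, smul_zero]
  · have e : f • y3 = y - diff x y2 := funext hy3
    have e2 := congrArg (diff x) e
    rw [diff_smul, diff_sub, diff_diff, sub_zero, hyz] at e2
    funext A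
    exact hreg (congrFun e2 A)

/-- The piece H_{i+1}(M) → H_{i+1}(N) → H_i(L) of the long exact sequence, by a diagram chase on
chains. -/
lemma Van.of_exact {L : Type*} [AddCommGroup L] [Module R L] {x : Fin n → R}
    {ι : L →ₗ[R] M} {π : M →ₗ[R] N} (hι : Function.Injective ι) (hπ : Function.Surjective π)
    (hex : ∀ v, π v = 0 ↔ ∃ u, ι u = v) {i : ℕ} (hL : Van x L i) (hM : Van x M (i + 1)) :
    Van x N (i + 1) := by
  intro z hz h0
  obtain ⟨y, hy, hyz⟩ := hz.lift hπ
  have ez : (fun A => π (y A)) = z := funext hyz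
  have h1 : ∀ A, ∃ u, ι u = diff x y A := fun A => by
    rw [← hex]
    have := congrFun (diff_comp x π y) A
    rw [ez, h0] at this
    exact this.symm
  choose a ha using h1
  have ea : (fun A => ι (a A)) = diff x y := funext ha
  obtain ⟨a', ha', haa⟩ := hL a
    (fun A hA => hι (by rw [ha, hy.diff A hA, map_zero]))
    (by
      funext A
      apply hι
      have := congrFun (diff_comp x ι a) A
      rw [ea, diff_diff] at this
      rw [← this, Pi.zero_apply, Pi.zero_apply, map_zero])
  have e2 : diff x (fun A => ι (a' A)) = diff x y := by
    rw [diff_comp, haa, ea]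
  obtain ⟨b, hb, hbb⟩ := hM (y - fun A => ι (a' A)) (hy.sub (ha'.comp ι))
    (by rw [diff_sub, e2, sub_self])
  refine ⟨fun A => π (b A), hb.comp π, ?_⟩
  rw [diff_comp, hbb]
  funext A
  rw [Pi.sub_apply, map_sub, hyz, (hex _).2 ⟨_, rfl⟩, sub_zero]

lemma Van.zero_of_surjective {x : Fin n → R} {π : M →ₗ[R] N} (hπ : Function.Surjective π)
    (hM : Van x M 0) : Van x N 0 := by
  intro z hz _
  obtain ⟨y, hy, hyz⟩ := hz.lift hπ
  obtain ⟨w, hw, hwy⟩ := hM y hy (by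
    funext A
    refine sum_eq_zero fun l _ => ?_
    unfold contr
    split_ifs with hl
    · simp
    · rw [hy _ (by rw [card_insert_of_notMem hl]; omega), smul_zero, smul_zero])
  refine ⟨fun A => π (w A), hw.comp π, ?_⟩
  rw [diff_comp, hwy]
  exact funext hyz

lemma Van.of_lt (x : Fin n → R) {i : ℕ} (h : n < i) : Van x M i := by
  intro z hz _
  refine ⟨0, fun _ _ => rfl, ?_⟩
  rw [diff_zero]
  funext A
  refine (hz A ?_).symm
  have := card_le_univ A
  rw [Fintype.card_fin] at this
  omega

/-! ### Depth sensitivity of Koszul homology -/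

open RingTheory.Sequence

/-- Dividing by a regular element of the ideal shifts the vanishing range by one degree
(`Van.of_quotient`), and above degree n there are no chains. -/
lemma Van.of_isWeaklyRegular {x : Fin n → R} (rs : List R) :
    ∀ {M : Type _} [AddCommGroup M] [Module R M],
      (∀ r ∈ rs, r ∈ Ideal.span (Set.range x)) → IsWeaklyRegular M rs →
      ∀ {i : ℕ}, n < i + rs.length → Van x M i := by
  induction rs with
  | nil => intro M _ _ _ _ i hi; exact Van.of_lt x (by simpa using hi)
  | cons r rs ih =>
    intro M _ _ hmem hreg i hi
    rw [isWeaklyRegular_cons_iff] at hreg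
    have := ih (fun r hr => hmem r (List.mem_cons_of_mem _ hr)) hreg.2 (i := i + 1)
      (by simp only [List.length_cons] at hi; omega)
    refine this.of_quotient (hmem r List.mem_cons_self) hreg.1
      (Submodule.mkQ_surjective (r • (⊤ : Submodule R M))) fun v => ?_
    rw [Submodule.mkQ_apply, Submodule.Quotient.mk_eq_zero, Submodule.mem_smul_pointwise_iff_exists]
    simp

/-- If the top Koszul homology vanishes then some element of the ideal is regular. -/
lemma exists_isSMulRegular [IsNoetherianRing R] [Module.Finite R M] {x : Fin n → R}
    (h : Van x M n) : ∃ f ∈ Ideal.span (Set.range x), IsSMulRegular M f := by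
  by_contra! hcon
  have hsub : (Ideal.span (Set.range x) : Set R) ⊆ ⋃ p ∈ associatedPrimes R M, (p : Set R) := by
    rw [biUnion_associatedPrimes_eq_zero_divisors]
    intro f hf
    have := hcon f hf
    rw [isSMulRegular_iff_right_eq_zero_of_smul] at this
    push Not at this
    obtain ⟨v, hv, hv0⟩ := this
    exact ⟨v, hv0, hv⟩
  obtain ⟨P, hP, hle⟩ := ((Ideal.span (Set.range x)).subset_union_prime_finite
    (associatedPrimes.finite R M) (f := id) 0 0 fun _ h _ _ => h.isPrime).1 hsub
  obtain ⟨hprime, v, hv⟩ := (isAssociatedPrime_iff).1 hP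
  have hkill : ∀ l, x l • v = 0 := fun l => by
    have : x l ∈ P := hle (Ideal.subset_span ⟨l, rfl⟩)
    rw [hv, Submodule.mem_colon_singleton] at this
    simpa using this
  have hv0 : v ≠ 0 := by
    rintro rfl
    apply hprime.ne_top
    rw [hv]
    ext; simp
  -- Top homology is the submodule of elements killed by every x l: v placed at `univ` is a cycle,
  -- and it can only be a boundary if it is zero since there are no chains of degree n + 1.
  obtain ⟨y, hy, hyz⟩ := h (fun A => if A = univ then v else 0)
    (fun A hA => if_neg (by rintro rfl; simp at hA))
    (by
      funext A
      refine sum_eq_zero fun l _ => ?_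
      unfold contr
      split_ifs <;> simp [smul_comm, hkill])
  have : y = 0 := by
    funext A
    refine hy A ?_
    have := card_le_univ A
    rw [Fintype.card_fin] at this
    omega
  rw [this, diff_zero] at hyz
  exact hv0 (by simpa using (congrFun hyz univ).symm)

/-- Converse of `Van.of_isWeaklyRegular`: vanishing in degree n yields one regular element, and
passing to the quotient by it costs only the lowest degree of the vanishing range. -/
lemma exists_isWeaklyRegular [IsNoetherianRing R] {x : Fin n → R} (t : ℕ) :
    ∀ {M : Type _} [AddCommGroup M] [Module R M] [Module.Finite R M],
      (∀ i, n < i + t → Van x M i) →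
      ∃ rs : List R, rs.length = t ∧ (∀ r ∈ rs, r ∈ Ideal.span (Set.range x)) ∧
        IsWeaklyRegular M rs := by
  induction t with
  | zero => intro M _ _ _ _; exact ⟨[], rfl, by simp, IsWeaklyRegular.nil R M⟩
  | succ t ih =>
    intro M _ _ _ h
    obtain ⟨f, hf, hreg⟩ := exists_isSMulRegular (h n (by omega))
    obtain ⟨rs, hlen, hmem, hrs⟩ := ih (M := QuotSMulTop f M) (fun i hi => by
      rcases i with _ | i
      · exact (h 0 (by omega)).zero_of_surjective (π := Submodule.mkQ (f • (⊤ : Submodule R M)))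
          (Submodule.mkQ_surjective _)
      · refine Van.of_exact (ι := LinearMap.lsmul R M f)
          (π := Submodule.mkQ (f • (⊤ : Submodule R M))) hreg
          (Submodule.mkQ_surjective _) (fun v => ?_) (h i (by omega)) (h (i + 1) (by omega))
        rw [Submodule.mkQ_apply, Submodule.Quotient.mk_eq_zero,
          Submodule.mem_smul_pointwise_iff_exists]
        simp)
    exact ⟨f :: rs, by simp [hlen], by
      intro r hr
      rcases List.mem_cons.1 hr with rfl | hr
      · exact hf
      · exact hmem r hr, by
      rw [isWeaklyRegular_cons_iff]; exact ⟨hreg, hrs⟩⟩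

end Koszul

/-! ### Monomial ideals: depth, associated primes, linear quotients -/

namespace MonomialIdeal

open MvPolynomial Koszul

variable {K : Type*} [Field K] {n : ℕ}

/-- The sequence of variables. -/
noncomputable abbrev vars (K : Type*) [Field K] (n : ℕ) : Fin n → MvPolynomial (Fin n) K := X

lemma one_notMem_idealOfVars : (1 : MvPolynomial (Fin n) K) ∉
    Ideal.span (Set.range (X (R := K) (σ := Fin n))) := by
  intro h
  rw [← Set.image_univ, mem_ideal_span_X_image] at h
  obtain ⟨i, -, hi⟩ := h 0 (by simp)
  exact hi rfl

/-- Depth is determined by the top nonvanishing Koszul homology. -/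
theorem depthQuot_eq {J : Ideal (MvPolynomial (Fin n) K)}
    (hJ : J ≤ Ideal.span (Set.range (X (R := K) (σ := Fin n)))) {p : ℕ}
    (hvan : ∀ i, p < i → Van (vars K n) (MvPolynomial (Fin n) K ⧸ J) i)
    (hnot : ¬ Van (vars K n) (MvPolynomial (Fin n) K ⧸ J) p) :
    depthQuot J = ((n - p : ℕ) : ℕ∞) := by
  have hp : p ≤ n := by
    by_contra h
    exact hnot (Van.of_lt _ (by omega))
  apply le_antisymm
  · refine iSup₂_le fun rs hrs => ?_
    obtain ⟨hmem, hreg⟩ := hrs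
    have : ¬ n < p + rs.length := fun h => hnot (Van.of_isWeaklyRegular rs hmem hreg.1 h)
    exact_mod_cast (by omega : rs.length ≤ n - p)
  · obtain ⟨rs, hlen, hmem, hreg⟩ := exists_isWeaklyRegular (n - p)
      (M := MvPolynomial (Fin n) K ⧸ J) (x := vars K n) (fun i hi => hvan i (by omega))
    rw [← hlen]
    refine le_iSup₂_of_le rs ⟨hmem, hreg, fun h => ?_⟩ le_rfl
    set 𝔪 := Ideal.span (Set.range (X (R := K) (σ := Fin n)))
    -- Regularity also requires a nonzero quotient; this holds because J and the sequence both lie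
    -- in the proper ideal `𝔪`.
    have h1 : Ideal.ofList rs • (⊤ : Submodule _ (MvPolynomial (Fin n) K ⧸ J)) ≤
        Submodule.map (Submodule.mkQ J) 𝔪 := by
      refine Submodule.smul_le.2 fun r hr v _ => ?_
      obtain ⟨g, rfl⟩ := Submodule.mkQ_surjective J v
      have hr' : r ∈ 𝔪 := by
        refine (Ideal.span_le.2 ?_ : Ideal.ofList rs ≤ 𝔪) hr
        exact fun a ha => hmem a ha
      exact ⟨r * g, Ideal.mul_mem_right _ _ hr', by rw [← smul_eq_mul, map_smul]⟩
    have h2 : Submodule.mkQ J 1 ∈ Submodule.map (Submodule.mkQ J) 𝔪 := h1 (h ▸ trivial)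
    obtain ⟨a, ha, hae⟩ := h2
    rw [← sub_eq_zero, ← map_sub, Submodule.mkQ_apply, Submodule.Quotient.mk_eq_zero] at hae
    apply one_notMem_idealOfVars (K := K) (n := n)
    have := Ideal.sub_mem _ ha (hJ hae)
    simpa using this

/-- The monomial ideal with a given set of exponents of generators. -/
noncomputable abbrev spanMon (K : Type*) [Field K] {n : ℕ} (B : Set (Fin n →₀ ℕ)) :
    Ideal (MvPolynomial (Fin n) K) :=
  Ideal.span ((fun u => monomial u (1 : K)) '' B)

/-- The ideal generated by a set of variables. -/
noncomputable abbrev varIdeal (K : Type*) [Field K] {n : ℕ} (F : Set (Fin n)) :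
    Ideal (MvPolynomial (Fin n) K) :=
  Ideal.span (X '' F)

open scoped Classical in
/-- Substituting zero for the variables in `F`. -/
noncomputable def killVars (K : Type*) [Field K] {n : ℕ} (F : Set (Fin n)) :
    MvPolynomial (Fin n) K →ₐ[K] MvPolynomial (Fin n) K :=
  aeval fun i => if i ∈ F then 0 else X i

lemma sub_killVars_mem (F : Set (Fin n)) (g : MvPolynomial (Fin n) K) :
    g - killVars K F g ∈ varIdeal K F := by
  have : (Ideal.Quotient.mkₐ K (varIdeal K F)).comp (killVars K F) =
      Ideal.Quotient.mkₐ K (varIdeal K F) := by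
    ext i
    simp only [killVars, AlgHom.comp_apply, aeval_X]
    split_ifs with h
    · rw [map_zero]
      exact ((Ideal.Quotient.eq_zero_iff_mem).2 (Ideal.subset_span (Set.mem_image_of_mem X h))).symm
    · rfl
  have h := DFunLike.congr_fun this g
  exact (Ideal.Quotient.mk_eq_mk_iff_sub_mem g (killVars K F g)).1 h.symm

lemma mem_varIdeal_iff {F : Set (Fin n)} {g : MvPolynomial (Fin n) K} :
    g ∈ varIdeal K F ↔ killVars K F g = 0 := by
  constructor
  · intro h
    have : varIdeal K F ≤ RingHom.ker (killVars K F) := by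
      refine Ideal.span_le.2 ?_
      rintro _ ⟨i, hi, rfl⟩
      simp [killVars, hi]
    exact this h
  · intro h
    have := sub_killVars_mem F g
    rwa [h, sub_zero] at this

lemma varIdeal_isPrime (F : Set (Fin n)) : (varIdeal K F).IsPrime := by
  have : varIdeal K F = RingHom.ker (killVars K F) := by
    ext g; exact mem_varIdeal_iff
  rw [this]
  exact RingHom.ker_isPrime _

lemma X_mem_varIdeal_iff {F : Set (Fin n)} {i : Fin n} :
    (X i : MvPolynomial (Fin n) K) ∈ varIdeal K F ↔ i ∈ F := by
  rw [mem_varIdeal_iff]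
  simp only [killVars, aeval_X]
  split_ifs with h <;> simp [h]

lemma varIdeal_injective : Function.Injective (varIdeal K (n := n)) := by
  intro F G h
  ext i
  rw [← X_mem_varIdeal_iff (K := K), h, X_mem_varIdeal_iff]

lemma monomial_mem_spanMon {B : Set (Fin n →₀ ℕ)} {v : Fin n →₀ ℕ} :
    (monomial v (1 : K)) ∈ spanMon K B ↔ ∃ u ∈ B, u ≤ v := by
  rw [mem_ideal_span_monomial_image]
  simp

lemma support_killVars {F : Set (Fin n)} {g : MvPolynomial (Fin n) K} {m : Fin n →₀ ℕ}
    (hm : m ∈ (killVars K F g).support) {i : Fin n} (hi : i ∈ F) : m i = 0 := by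
  by_contra h
  rw [mem_support_iff] at hm
  apply hm
  clear hm
  induction g using MvPolynomial.induction_on generalizing m with
  | C a =>
    rw [killVars, aeval_C, algebraMap_eq, coeff_C, if_neg]
    rintro rfl
    exact h rfl
  | add p q hp hq => rw [map_add, coeff_add, hp h, hq h, add_zero]
  | mul_X p j ih =>
    rw [map_mul]
    nth_rewrite 2 [killVars]
    rw [aeval_X]
    split_ifs with hj
    · simp
    · rw [coeff_mul_X']
      split_ifs
      · refine ih ?_
        have : j ≠ i := by rintro rfl; exact hj hi
        simpa [Finsupp.single_apply, this] using h
      · rfl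

/-- Associated primes of a monomial ideal come from monomials. -/
theorem mem_associatedPrimes_iff {B : Set (Fin n →₀ ℕ)} {D : ℕ}
    (hB : ∀ u ∈ B, ∀ i, u i ≤ D) {P : Ideal (MvPolynomial (Fin n) K)} :
    P ∈ associatedPrimes (MvPolynomial (Fin n) K) (MvPolynomial (Fin n) K ⧸ spanMon K B) ↔
      ∃ F : Set (Fin n), P = varIdeal K F ∧ ∃ w : Fin n →₀ ℕ, (¬ ∃ u ∈ B, u ≤ w) ∧
        (∀ p, p ∉ F → D ≤ w p) ∧ ∀ l ∈ F, ∃ u ∈ B, u ≤ w + Finsupp.single l 1 := by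
  classical
  have hcol : ∀ f g : MvPolynomial (Fin n) K,
      g ∈ Submodule.colon (⊥ : Submodule (MvPolynomial (Fin n) K)
        (MvPolynomial (Fin n) K ⧸ spanMon K B)) {Submodule.Quotient.mk f} ↔
        g * f ∈ spanMon K B := fun f g => by
    rw [Submodule.mem_colon_singleton, ← Submodule.Quotient.mk_smul, Submodule.mem_bot,
      Submodule.Quotient.mk_eq_zero, smul_eq_mul]
  rw [AssociatedPrimes.mem_iff, isAssociatedPrime_iff]
  constructor
  · rintro ⟨hprime, v, hv⟩
    obtain ⟨f, rfl⟩ := Submodule.Quotient.mk_surjective _ v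
    have hP : ∀ g, g ∈ P ↔ g * f ∈ spanMon K B := fun g => by rw [← hcol, ← hv]
    set F : Set (Fin n) := {l | X l ∈ P} with hF
    -- Multiplying f by a monomial outside the prime P keeps its annihilator and makes every
    -- exponent off F at least D, beyond the reach of the generators.
    let s : Fin n →₀ ℕ := Finsupp.equivFunOnFinite.symm fun p => if p ∈ F then 0 else D
    have hs : monomial s (1 : K) ∉ P := by
      rw [monomial_eq, Finsupp.prod]
      intro h
      simp only [map_one, one_mul] at h
      obtain ⟨p, hp, hpP⟩ := (hprime.prod_mem_iff).1 h
      have h1 : p ∈ F := hprime.mem_of_pow_mem _ hpP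
      simp [s, h1] at hp
    set f1 := f * monomial s (1 : K) with hf1
    have hP1 : ∀ g, g ∈ P ↔ g * f1 ∈ spanMon K B := fun g => by
      have : g * f1 = (g * monomial s 1) * f := by rw [hf1]; ring
      rw [this, ← hP]
      exact ⟨fun h => Ideal.mul_mem_right _ _ h, fun h => (hprime.mem_or_mem h).resolve_right hs⟩
    -- Dropping the terms already in the ideal does not change the annihilator and puts every
    -- remaining monomial, in particular the leading one, outside the ideal.
    set f2 : MvPolynomial (Fin n) K :=
      ∑ m ∈ f1.support.filter (fun m => ¬ ∃ u ∈ B, u ≤ m), monomial m (coeff m f1) with hf2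
    have hcoeff : ∀ m, coeff m f2 = if ∃ u ∈ B, u ≤ m then 0 else coeff m f1 := fun m => by
      rw [hf2, coeff_sum]
      simp only [coeff_monomial, Finset.sum_ite_eq', Finset.mem_filter, mem_support_iff]
      by_cases h1 : ∃ u ∈ B, u ≤ m
      · simp [h1]
      · by_cases h2 : coeff m f1 = 0 <;> simp [h1, h2]
    have hdiff : f1 - f2 ∈ spanMon K B := by
      rw [mem_ideal_span_monomial_image]
      intro m hm
      by_contra hcon
      rw [mem_support_iff, coeff_sub, hcoeff, if_neg hcon, sub_self] at hm
      exact hm rfl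
    have hP2 : ∀ g, g ∈ P ↔ g * f2 ∈ spanMon K B := fun g => by
      rw [hP1]
      have h3 := Ideal.mul_mem_left _ g hdiff
      rw [mul_sub] at h3
      exact ⟨fun h => by
        simpa using Ideal.sub_mem _ h h3, fun h => by simpa using Ideal.add_mem _ h3 h⟩
    have hf20 : f2 ≠ 0 := by
      intro h
      apply hprime.ne_top
      rw [Ideal.eq_top_iff_one, hP2, h, mul_zero]
      exact Ideal.zero_mem _
    let w := MonomialOrder.lex.degree f2
    have hw : w ∈ f2.support := MonomialOrder.lex.degree_mem_support hf20
    have hw1 : ¬ ∃ u ∈ B, u ≤ w := fun h => by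
      rw [mem_support_iff, hcoeff, if_pos h] at hw
      exact hw rfl
    have hw2 : s ≤ w := by
      rw [mem_support_iff, hcoeff, if_neg hw1, hf1, coeff_mul_monomial'] at hw
      by_contra h
      rw [if_neg h] at hw
      exact hw rfl
    have hw3 : ∀ p, p ∉ F → D ≤ w p := fun p hp => by
      have := hw2 p
      simpa [s, hp] using this
    refine ⟨F, le_antisymm (fun g hg => ?_) (Ideal.span_le.2 ?_), w, hw1, hw3, fun l hl => ?_⟩
    -- Modulo P, g may be replaced by its part free of F. If that part is nonzero, its leading
    -- monomial times w lies above some generator u. On F nothing was added to w, and off F w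
    -- already dominates u, so u ≤ w, a contradiction.
    · rw [mem_varIdeal_iff]
      by_contra hg0
      have hFP : varIdeal K F ≤ P := Ideal.span_le.2 (by rintro _ ⟨i, hi, rfl⟩; exact hi)
      have h1 : killVars K F g ∈ P := by
        have := Ideal.sub_mem _ hg (hFP (sub_killVars_mem F g))
        simpa using this
      rw [hP2, mem_ideal_span_monomial_image] at h1
      have hne := mul_ne_zero hg0 hf20
      obtain ⟨u, hu, hle⟩ := h1 _ (MonomialOrder.lex.degree_mem_support hne)
      rw [MonomialOrder.degree_mul hg0 hf20] at hle
      refine hw1 ⟨u, hu, fun i => ?_⟩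
      by_cases hi : i ∈ F
      · have h2 := hle i
        rw [Finsupp.add_apply, support_killVars (MonomialOrder.lex.degree_mem_support hg0) hi,
          zero_add] at h2
        exact h2
      · exact (hB u hu i).trans (hw3 i hi)
    · rintro _ ⟨i, hi, rfl⟩; exact hi
    · have h1 : X l * f2 ∈ spanMon K B := (hP2 _).1 hl
      rw [mem_ideal_span_monomial_image] at h1
      refine h1 _ ?_
      rw [mem_support_iff, add_comm, coeff_X_mul, ← mem_support_iff]
      exact hw
  · rintro ⟨F, rfl, w, hw1, hw2, hw3⟩
    refine ⟨varIdeal_isPrime F, Submodule.Quotient.mk (monomial w 1), le_antisymm ?_ fun g hg => ?_⟩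
    · refine Ideal.span_le.2 ?_
      rintro _ ⟨l, hl, rfl⟩
      rw [SetLike.mem_coe, hcol, X, monomial_mul, one_mul, monomial_mem_spanMon, add_comm]
      exact hw3 l hl
    · rw [hcol, mem_ideal_span_monomial_image] at hg
      rw [mem_ideal_span_X_image]
      intro m hm
      by_contra! hcon
      obtain ⟨u, hu, hle⟩ := hg (m + w) (by
        rw [mem_support_iff, coeff_mul_monomial, mul_one]; exact mem_support_iff.1 hm)
      refine hw1 ⟨u, hu, fun i => ?_⟩
      by_cases hi : i ∈ F
      · have := hle i
        rwa [Finsupp.add_apply, hcon i hi, zero_add] at this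
      · exact (hB u hu i).trans (hw2 i hi)

/-- Induction on the number of variables outside F: such a variable is regular on the domain S/P_F,
with quotient S/P_{F ∪ {l}}. -/
lemma van_varIdeal (F : Finset (Fin n)) {i : ℕ} (hi : F.card < i) :
    Van (vars K n) (MvPolynomial (Fin n) K ⧸ varIdeal K (F : Set (Fin n))) i := by
  induction hc : n - F.card generalizing F i with
  | zero =>
    exact Van.of_lt _ (by omega)
  | succ c ih =>
    obtain ⟨l, hl⟩ : ∃ l, l ∉ F := by
      by_contra! h
      have : F = Finset.univ := Finset.eq_univ_of_forall h
      rw [this, Finset.card_univ, Fintype.card_fin] at hc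
      omega
    have hcard : (insert l F).card = F.card + 1 := Finset.card_insert_of_notMem hl
    have h1 := ih (insert l F) (i := i + 1) (by omega) (by omega)
    have hle : varIdeal K (F : Set (Fin n)) ≤ varIdeal K (↑(insert l F) : Set (Fin n)) :=
      Ideal.span_mono (Set.image_mono (by simp))
    refine Van.of_quotient (f := X l) (Ideal.subset_span ⟨l, rfl⟩) ?_
      (π := Submodule.factor hle) (Submodule.factor_surjective hle) ?_ h1
    · rw [isSMulRegular_iff_right_eq_zero_of_smul]
      intro v hv
      obtain ⟨g, rfl⟩ := Submodule.Quotient.mk_surjective _ v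
      rw [← Submodule.Quotient.mk_smul, Submodule.Quotient.mk_eq_zero, smul_eq_mul] at hv
      rw [Submodule.Quotient.mk_eq_zero]
      exact ((varIdeal_isPrime _).mem_or_mem hv).resolve_left
        fun h => hl (by simpa using X_mem_varIdeal_iff.1 h)
    · intro v
      obtain ⟨g, rfl⟩ := Submodule.Quotient.mk_surjective _ v
      have hfac : Submodule.factor hle (Submodule.Quotient.mk g) = Submodule.Quotient.mk g := rfl
      rw [hfac, Submodule.Quotient.mk_eq_zero, Finset.coe_insert, varIdeal,
        Set.image_insert_eq, Ideal.span_insert, Submodule.mem_sup]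
      constructor
      · rintro ⟨a, ha, c, hc, rfl⟩
        obtain ⟨e, rfl⟩ := Ideal.mem_span_singleton'.1 ha
        refine ⟨Submodule.Quotient.mk e, ?_⟩
        rw [← Submodule.Quotient.mk_smul, Submodule.Quotient.eq, smul_eq_mul, mul_comm e,
          sub_add_cancel_left]
        exact Submodule.neg_mem _ hc
      · rintro ⟨u, hu⟩
        obtain ⟨e, rfl⟩ := Submodule.Quotient.mk_surjective _ u
        rw [← Submodule.Quotient.mk_smul, eq_comm, Submodule.Quotient.eq, smul_eq_mul] at hu
        exact ⟨X l * e, Ideal.mul_mem_right _ _ (Ideal.subset_span rfl), _, hu, by ring⟩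

/-- Koszul homology of a monomial ideal with linear quotients in the lexicographic order. -/
theorem van_of_linear_quotients {B : Finset (Fin n →₀ ℕ)} {G : (Fin n →₀ ℕ) → Finset (Fin n)}
    {q : ℕ} (hG : ∀ u ∈ B, (G u).card ≤ q)
    (hlt : ∀ u ∈ B, ∀ v ∈ B, toLex u < toLex v → ∃ l ∈ G u, u l < v l)
    (hmem : ∀ u ∈ B, ∀ l ∈ G u, ∃ v ∈ B, toLex u < toLex v ∧ v ≤ u + Finsupp.single l 1)
    {i : ℕ} (hi : q + 1 < i) :
    Van (vars K n) (MvPolynomial (Fin n) K ⧸ spanMon K (B : Set (Fin n →₀ ℕ))) i := by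
  suffices H : ∀ c : ℕ, ∀ U ⊆ B, U.card = c →
      (∀ u ∈ U, ∀ v ∈ B, toLex u < toLex v → v ∈ U) →
      Van (vars K n) (MvPolynomial (Fin n) K ⧸ spanMon K (U : Set (Fin n →₀ ℕ))) i from
    H _ B subset_rfl rfl fun _ _ v hv _ => hv
  intro c
  induction c with
  | zero =>
    intro U _ hU _
    rw [Finset.card_eq_zero] at hU
    subst hU
    have e : spanMon K (↑(∅ : Finset (Fin n →₀ ℕ)) : Set (Fin n →₀ ℕ)) =
        varIdeal K (↑(∅ : Finset (Fin n)) : Set (Fin n)) := by simp [spanMon, varIdeal]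
    rw [e]
    exact van_varIdeal _ (by simp; omega)
  | succ c ih =>
    intro U hUB hcard hup
    have hne : U.Nonempty := Finset.card_pos.1 (by omega)
    obtain ⟨u, huU, hmin⟩ := Finset.exists_min_image U (fun u => toLex u) hne
    have hmin' : ∀ v ∈ U.erase u, toLex u < toLex v := fun v hv =>
      lt_of_le_of_ne (hmin v (Finset.mem_of_mem_erase hv))
        fun h => Finset.ne_of_mem_erase hv (toLex.injective h.symm)
    have h1 := ih (U.erase u) ((Finset.erase_subset _ _).trans hUB)
      (by rw [Finset.card_erase_of_mem huU]; omega)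
      (fun v hv v' hv' hlt' => Finset.mem_erase.2
        ⟨fun h => (hmin' v hv).not_gt (h ▸ hlt'), hup v (Finset.mem_of_mem_erase hv) v' hv' hlt'⟩)
    have hle : spanMon K (↑(U.erase u) : Set (Fin n →₀ ℕ)) ≤ spanMon K (U : Set (Fin n →₀ ℕ)) :=
      Ideal.span_mono (Set.image_mono (Finset.coe_subset.2 (Finset.erase_subset _ _)))
    obtain ⟨i, rfl⟩ : ∃ j, i = j + 1 := ⟨i - 1, by omega⟩
    have h2 : Van (vars K n) (MvPolynomial (Fin n) K ⧸ varIdeal K (G u : Set (Fin n))) i :=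
      van_varIdeal _ (by have := hG u (hUB huU); omega)
    -- With J' generated by U without its lex-smallest element u, the hypotheses identify J' : x^u
    -- with `varIdeal K (G u)`. Here `hmem` gives one inclusion, and `hlt` gives the other as
    -- injectivity of multiplication by x^u from S/P_{G u} to S/J'. The cokernel of this map is the
    -- quotient by the ideal of U.
    have hwd : varIdeal K (G u : Set (Fin n)) ≤
        Submodule.comap
          (LinearMap.lsmul (MvPolynomial (Fin n) K) (MvPolynomial (Fin n) K) (monomial u 1))
          (spanMon K (↑(U.erase u) : Set (Fin n →₀ ℕ))) := by
      refine Ideal.span_le.2 ?_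
      rintro _ ⟨l, hl, rfl⟩
      rw [SetLike.mem_coe, Submodule.mem_comap, LinearMap.lsmul_apply, smul_eq_mul, X,
        monomial_mul, one_mul]
      refine monomial_mem_spanMon.2 ?_
      obtain ⟨v, hv, hlt', hle'⟩ := hmem u (hUB huU) l hl
      refine ⟨v, ?_, hle'⟩
      rw [Finset.mem_coe, Finset.mem_erase]
      exact ⟨fun h => hlt'.ne (by rw [h]), hup u huU v hv hlt'⟩
    refine Van.of_exact (ι := Submodule.mapQ _ _ _ hwd) (π := Submodule.factor hle) ?_
      (Submodule.factor_surjective hle) ?_ h2 h1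
    · rw [← LinearMap.ker_eq_bot, LinearMap.ker_eq_bot']
      intro v hv
      obtain ⟨g, rfl⟩ := Submodule.Quotient.mk_surjective _ v
      rw [Submodule.mapQ_apply, Submodule.Quotient.mk_eq_zero, LinearMap.lsmul_apply,
        smul_eq_mul, mem_ideal_span_monomial_image] at hv
      rw [Submodule.Quotient.mk_eq_zero, mem_ideal_span_X_image]
      intro m hm
      obtain ⟨v, hvU, hle'⟩ := hv (u + m) (by
        rw [mem_support_iff, coeff_monomial_mul, one_mul]; exact mem_support_iff.1 hm)
      obtain ⟨l, hl, hl'⟩ := hlt u (hUB huU) v (hUB (Finset.mem_of_mem_erase hvU)) (hmin' v hvU)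
      refine ⟨l, hl, ?_⟩
      have := hle' l
      rw [Finsupp.add_apply] at this
      omega
    · intro v
      obtain ⟨g, rfl⟩ := Submodule.Quotient.mk_surjective _ v
      have hfac : Submodule.factor hle (Submodule.Quotient.mk g) = Submodule.Quotient.mk g := rfl
      rw [hfac, Submodule.Quotient.mk_eq_zero]
      conv_lhs => rw [← Finset.insert_erase huU, Finset.coe_insert, spanMon,
        Set.image_insert_eq, Ideal.span_insert, Submodule.mem_sup]
      constructor
      · rintro ⟨a, ha, c, hc, rfl⟩
        obtain ⟨e, rfl⟩ := Ideal.mem_span_singleton'.1 ha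
        refine ⟨Submodule.Quotient.mk e, ?_⟩
        rw [Submodule.mapQ_apply, Submodule.Quotient.eq, LinearMap.lsmul_apply, smul_eq_mul,
          mul_comm e, sub_add_cancel_left]
        exact Submodule.neg_mem _ hc
      · rintro ⟨u', hu'⟩
        obtain ⟨e, rfl⟩ := Submodule.Quotient.mk_surjective _ u'
        rw [Submodule.mapQ_apply, eq_comm, Submodule.Quotient.eq, LinearMap.lsmul_apply,
          smul_eq_mul] at hu'
        exact ⟨monomial u 1 * e, Ideal.mul_mem_right _ _ (Ideal.subset_span rfl), _, hu', by ring⟩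

/-- A linear syzygy yields nonvanishing Koszul homology. -/
theorem not_van_of_linear {B : Set (Fin n →₀ ℕ)} {d p : ℕ} (hB : ∀ u ∈ B, u.degree = d)
    {z : Finset (Fin n) → MvPolynomial (Fin n) K} (hz : Supp z p)
    (hmem : ∀ A, Koszul.diff (vars K n) z A ∈ spanMon K B)
    (hhom : ∀ A, ∀ m ∈ (Koszul.diff (vars K n) z A).support, m.degree = d)
    (h0 : Koszul.diff (vars K n) z ≠ 0) :
    ¬ Van (vars K n) (MvPolynomial (Fin n) K ⧸ spanMon K B) p := by
  intro hvan
  -- If z were a boundary modulo the ideal J, then z − ∂y' would have coefficients in J, hence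
  -- without terms of degree below d. The boundary ∂z = ∂(z − ∂y') would then have no terms of
  -- degree d, although it is nonzero and homogeneous of that degree.
  have hJ : ∀ g ∈ spanMon K B, ∀ m, m.degree < d → coeff m g = 0 := fun g hg m hm => by
    by_contra h
    obtain ⟨u, hu, hle⟩ := mem_ideal_span_monomial_image.1 hg m (mem_support_iff.2 h)
    have := Finsupp.degree_mono hle
    rw [hB u hu] at this
    omega
  obtain ⟨y, hy, hyz⟩ := hvan (fun A => Submodule.mkQ (spanMon K B) (z A)) (hz.comp _) (by
    rw [diff_comp]
    funext A
    exact (Submodule.Quotient.mk_eq_zero _).2 (hmem A))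
  obtain ⟨y', hy', hyy⟩ := hy.lift (Submodule.mkQ_surjective (spanMon K B))
  have hy2 : (fun A => Submodule.mkQ (spanMon K B) (y' A)) = y := funext hyy
  have h1 : ∀ A, (z - Koszul.diff (vars K n) y') A ∈ spanMon K B := fun A => by
    rw [← Submodule.Quotient.mk_eq_zero, ← Submodule.mkQ_apply, Pi.sub_apply, map_sub, sub_eq_zero]
    have := congrFun (diff_comp (vars K n) (Submodule.mkQ (spanMon K B)) y') A
    rw [hy2, hyz] at this
    exact this
  have h2 : Koszul.diff (vars K n) z =
      Koszul.diff (vars K n) (z - Koszul.diff (vars K n) y') := by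
    rw [diff_sub, diff_diff, sub_zero]
  apply h0
  funext A
  ext m
  rw [Pi.zero_apply, coeff_zero]
  by_contra hm
  have hdeg := hhom A m (mem_support_iff.2 hm)
  apply hm
  rw [h2, Koszul.diff, coeff_sum]
  refine Finset.sum_eq_zero fun l _ => ?_
  rw [smul_eq_mul, coeff_X_mul']
  split_ifs with hl
  · refine hJ _ ?_ _ ?_
    · unfold contr
      split_ifs
      · exact Ideal.zero_mem _
      · exact zsmul_mem (h1 _) _
    · have h3 : m = (m - Finsupp.single l 1) + Finsupp.single l 1 := by
        rw [tsub_add_cancel_of_le]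
        rw [Finsupp.single_le_iff]
        exact Nat.one_le_iff_ne_zero.2 (Finsupp.mem_support_iff.1 hl)
      have h4 := congrArg Finsupp.degree h3
      rw [map_add, Finsupp.degree_single] at h4
      omega
  · rfl

end MonomialIdeal

/-! ### Right PLP-polymatroids indexed by natural numbers -/

namespace RightPLP

open Finset MonomialIdeal

/-- Extension by zero of a function on `Fin n`. -/
def ext {n : ℕ} (f : Fin n → ℕ) : ℕ → ℕ := fun l => if h : l < n then f ⟨l, h⟩ else 0

/-- Shift to one-based indexing, with value zero at zero. -/
def shift {n : ℕ} (f : Fin n → ℕ) : ℕ → ℕ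
  | 0 => 0
  | i + 1 => ext f i

/-- Restriction of a function to exponent vectors in `n` variables. -/
noncomputable def expo (n : ℕ) (f : ℕ → ℕ) : Fin n →₀ ℕ :=
  Finsupp.equivFunOnFinite.symm fun i => f i

/-- Normalised data of a right PLP-polymatroid: the bounds `α i`, `β i` apply to the sum of
the first `i` entries for `i ≤ κ`, and `b l` bounds the entry `l` for `κ ≤ l < n`. -/
structure Data (n κ d : ℕ) (α β b : ℕ → ℕ) : Prop where
  κ_pos : 0 < κ
  κ_lt : κ < n
  d_pos : 0 < d
  α_zero : α 0 = 0
  β_zero : β 0 = 0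
  α_mono : ∀ i j, i ≤ j → j ≤ κ → α i ≤ α j
  β_mono : ∀ i j, i ≤ j → j ≤ κ → β i ≤ β j
  α_le : ∀ i, i ≤ κ → α i ≤ β i
  β_one : 0 < β 1
  β_le : β κ ≤ d
  b_pos : ∀ l, κ ≤ l → l < n → 0 < b l
  d_le : d ≤ α κ + ∑ l ∈ Ico κ n, b l

/-- The bases of a right PLP-polymatroid. -/
structure IsBase (n κ d : ℕ) (α β b u : ℕ → ℕ) : Prop where
  le_sum : ∀ i, i ≤ κ → α i ≤ ∑ x ∈ range i, u x
  sum_le : ∀ i, i ≤ κ → ∑ x ∈ range i, u x ≤ β i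
  le_b : ∀ l, κ ≤ l → l < n → u l ≤ b l
  sum_eq : ∑ x ∈ range n, u x = d

/-- The exponent vectors of the bases. -/
def baseSet (n κ d : ℕ) (α β b : ℕ → ℕ) : Set (Fin n →₀ ℕ) :=
  {u | IsBase n κ d α β b (ext u)}

variable {n κ d : ℕ} {α β b : ℕ → ℕ}

lemma ext_apply (f : Fin n → ℕ) (i : Fin n) : ext f i = f i := by
  simp [ext]

lemma ext_of_lt (f : Fin n → ℕ) {l : ℕ} (h : l < n) : ext f l = f ⟨l, h⟩ := by
  simp [ext, h]

lemma ext_expo (f : ℕ → ℕ) {l : ℕ} (h : l < n) : ext (expo n f) l = f l := by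
  simp [ext, h, expo]

lemma expo_apply (f : ℕ → ℕ) (i : Fin n) : expo n f i = f i := by
  simp [expo]

lemma IsBase.congr {u v : ℕ → ℕ} (hκ : κ < n) (h : ∀ l, l < n → u l = v l)
    (hu : IsBase n κ d α β b u) : IsBase n κ d α β b v := by
  have hs : ∀ i, i ≤ n → ∑ x ∈ range i, v x = ∑ x ∈ range i, u x := fun i hi =>
    sum_congr rfl fun x hx => (h x (by have := mem_range.1 hx; omega)).symm
  refine ⟨fun i hi => ?_, fun i hi => ?_, fun l h1 h2 => ?_, ?_⟩
  · rw [hs i (by omega)]; exact hu.le_sum i hi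
  · rw [hs i (by omega)]; exact hu.sum_le i hi
  · rw [← h l h2]; exact hu.le_b l h1 h2
  · rw [hs n le_rfl]; exact hu.sum_eq

lemma expo_mem_baseSet (hκ : κ < n) {u : ℕ → ℕ} :
    expo n u ∈ baseSet n κ d α β b ↔ IsBase n κ d α β b u :=
  ⟨fun h => h.congr hκ fun _ hl => ext_expo u hl,
    fun h => h.congr hκ fun _ hl => (ext_expo u hl).symm⟩

lemma ext_add (u v : Fin n →₀ ℕ) (l : ℕ) : ext (u + v : Fin n →₀ ℕ) l = ext u l + ext v l := by
  unfold ext; split_ifs <;> simp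

lemma Data.scale (h : Data n κ d α β b) {m : ℕ} (hm : 0 < m) :
    Data n κ (m * d) (fun i => m * α i) (fun i => m * β i) (fun i => m * b i) where
  κ_pos := h.κ_pos
  κ_lt := h.κ_lt
  d_pos := Nat.mul_pos hm h.d_pos
  α_zero := by simp [h.α_zero]
  β_zero := by simp [h.β_zero]
  α_mono i j hi hj := Nat.mul_le_mul_left _ (h.α_mono i j hi hj)
  β_mono i j hi hj := Nat.mul_le_mul_left _ (h.β_mono i j hi hj)
  α_le i hi := Nat.mul_le_mul_left _ (h.α_le i hi)
  β_one := Nat.mul_pos hm h.β_one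
  β_le := Nat.mul_le_mul_left _ h.β_le
  b_pos l h1 h2 := Nat.mul_pos hm (h.b_pos l h1 h2)
  d_le := by
    rw [← mul_sum, ← mul_add]; exact Nat.mul_le_mul_left _ h.d_le

/-! ### Integer decomposition of bases and powers of the ideal -/

section Powers

lemma sub_div_bounds {m W a c : ℕ} (h1 : (m + 1) * a ≤ W) (h2 : W ≤ (m + 1) * c) :
    m * a ≤ W - W / (m + 1) ∧ W - W / (m + 1) ≤ m * c := by
  have hW := Nat.div_add_mod W (m + 1)
  have hr := Nat.mod_lt W (Nat.succ_pos m)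
  set s := W / (m + 1)
  set r := W % (m + 1)
  have has : a ≤ s := by rw [Nat.le_div_iff_mul_le (Nat.succ_pos m), mul_comm]; exact h1
  have h3 : W - s = m * s + r := by
    rw [← hW, add_mul, one_mul]; omega
  rw [h3]
  refine ⟨(Nat.mul_le_mul_left m has).trans (Nat.le_add_right _ _), ?_⟩
  rcases Nat.lt_or_ge s c with hsc | hsc
  · calc m * s + r ≤ m * s + m := by omega
      _ = m * (s + 1) := by ring
      _ ≤ m * c := Nat.mul_le_mul_left _ hsc
  · have h4 : (m + 1) * c ≤ (m + 1) * s := Nat.mul_le_mul_left _ hsc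
    have h5 : s = c := by
      have : (m + 1) * s ≤ (m + 1) * c := by omega
      exact le_antisymm (Nat.le_of_mul_le_mul_left this (Nat.succ_pos m)) hsc
    have h6 : r = 0 := by omega
    rw [h6, h5, add_zero]

lemma sub_div_mono {m W W' c : ℕ} (h1 : W ≤ W') (h2 : W' ≤ W + (m + 1) * c) :
    W / (m + 1) ≤ W' / (m + 1) ∧ W' / (m + 1) ≤ W / (m + 1) + c ∧
      W - W / (m + 1) ≤ W' - W' / (m + 1) ∧
      W' - W' / (m + 1) ≤ W - W / (m + 1) + m * c := by
  have e1 : W / (m + 1) ≤ W' / (m + 1) := Nat.div_le_div_right h1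
  have e2 : W' / (m + 1) ≤ W / (m + 1) + c := by
    calc W' / (m + 1) ≤ (W + (m + 1) * c) / (m + 1) := Nat.div_le_div_right h2
      _ = W / (m + 1) + c := Nat.add_mul_div_left _ _ (Nat.succ_pos m)
  refine ⟨e1, e2, ?_⟩
  have hW := Nat.div_add_mod W (m + 1)
  have hW' := Nat.div_add_mod W' (m + 1)
  have hr := Nat.mod_lt W (Nat.succ_pos m)
  have hr' := Nat.mod_lt W' (Nat.succ_pos m)
  set s := W / (m + 1)
  set s' := W' / (m + 1)
  set r := W % (m + 1)
  set r' := W' % (m + 1)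
  have h3 : W - s = m * s + r := by rw [← hW, add_mul, one_mul]; omega
  have h4 : W' - s' = m * s' + r' := by rw [← hW', add_mul, one_mul]; omega
  rw [h3, h4]
  rw [← hW, ← hW'] at h1 h2
  constructor
  · rcases Nat.eq_or_lt_of_le e1 with h | h
    · rw [← h] at h1 ⊢; omega
    · have : m * (s + 1) ≤ m * s' := Nat.mul_le_mul_left _ h
      rw [mul_add, mul_one] at this
      omega
  · rcases Nat.eq_or_lt_of_le e2 with h | h
    · rw [h, mul_add] at h2 ⊢; omega
    · have : m * (s' + 1) ≤ m * (s + c) := Nat.mul_le_mul_left _ h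
      rw [mul_add, mul_one, mul_add] at this
      omega

lemma IsBase.add {d' : ℕ} {α' β' b' u v : ℕ → ℕ} (hu : IsBase n κ d α β b u)
    (hv : IsBase n κ d' α' β' b' v) :
    IsBase n κ (d + d') (fun i => α i + α' i) (fun i => β i + β' i) (fun i => b i + b' i)
      (fun i => u i + v i) where
  le_sum i hi := by rw [sum_add_distrib]; exact Nat.add_le_add (hu.le_sum i hi) (hv.le_sum i hi)
  sum_le i hi := by rw [sum_add_distrib]; exact Nat.add_le_add (hu.sum_le i hi) (hv.sum_le i hi)
  le_b l h1 h2 := Nat.add_le_add (hu.le_b l h1 h2) (hv.le_b l h1 h2)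
  sum_eq := by rw [sum_add_distrib, hu.sum_eq, hv.sum_eq]

/-- With W i the partial sums of u, the partial sums of w are ⌊W i/(m+1)⌋ and those of v are the
rest. Rounding respects integral bounds on W and on its increments, so all constraints pass to the
two parts. -/
lemma IsBase.exists_add {m : ℕ} {u : ℕ → ℕ}
    (hu : IsBase n κ ((m + 1) * d) (fun i => (m + 1) * α i) (fun i => (m + 1) * β i)
      (fun i => (m + 1) * b i) u) :
    ∃ v w, IsBase n κ (m * d) (fun i => m * α i) (fun i => m * β i) (fun i => m * b i) v ∧
      IsBase n κ d α β b w ∧ ∀ l, u l = v l + w l := by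
  set W : ℕ → ℕ := fun i => ∑ x ∈ range i, u x with hWdef
  have hW0 : W 0 = 0 := by simp [W]
  have hWs : ∀ i, W (i + 1) = W i + u i := fun i => sum_range_succ _ _
  have hmono : ∀ i, W i ≤ W (i + 1) ∧ W (i + 1) ≤ W i + (m + 1) * u i := fun i => by
    rw [hWs]
    have : u i ≤ (m + 1) * u i := Nat.le_mul_of_pos_left _ (Nat.succ_pos m)
    omega
  have hstep := fun i => sub_div_mono (hmono i).1 (hmono i).2
  have hsv : ∀ i, ∑ x ∈ range i, ((W (x + 1) - W (x + 1) / (m + 1)) - (W x - W x / (m + 1))) =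
      W i - W i / (m + 1) := fun i => by
    induction i with
    | zero => simp [hW0]
    | succ i ih => rw [sum_range_succ, ih]; have := (hstep i).2.2.1; omega
  have hsw : ∀ i, ∑ x ∈ range i, (W (x + 1) / (m + 1) - W x / (m + 1)) =
      W i / (m + 1) := fun i => by
    induction i with
    | zero => simp [hW0]
    | succ i ih => rw [sum_range_succ, ih]; have := (hstep i).1; omega
  refine ⟨fun x => (W (x + 1) - W (x + 1) / (m + 1)) - (W x - W x / (m + 1)),
    fun x => W (x + 1) / (m + 1) - W x / (m + 1), ⟨?_, ?_, ?_, ?_⟩, ⟨?_, ?_, ?_, ?_⟩, ?_⟩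
  · intro i hi
    rw [hsv]
    exact (sub_div_bounds (hu.le_sum i hi) (hu.sum_le i hi)).1
  · intro i hi
    rw [hsv]
    exact (sub_div_bounds (hu.le_sum i hi) (hu.sum_le i hi)).2
  · intro l h1 h2
    have h3 : W (l + 1) ≤ W l + (m + 1) * b l := by
      rw [hWs]; have := hu.le_b l h1 h2; omega
    have := (sub_div_mono (hmono l).1 h3).2.2.2
    omega
  · rw [hsv]
    have hn : W n = (m + 1) * d := hu.sum_eq
    have := sub_div_bounds (m := m) (W := W n) (a := d) (c := d) hn.ge hn.le
    omega
  · intro i hi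
    rw [hsw, Nat.le_div_iff_mul_le (Nat.succ_pos m), mul_comm]
    exact hu.le_sum i hi
  · intro i hi
    rw [hsw]
    exact Nat.div_le_of_le_mul (hu.sum_le i hi)
  · intro l h1 h2
    have h3 : W (l + 1) ≤ W l + (m + 1) * b l := by
      rw [hWs]; have := hu.le_b l h1 h2; omega
    have := (sub_div_mono (hmono l).1 h3).2.1
    omega
  · rw [hsw]
    have hn : W n = (m + 1) * d := hu.sum_eq
    rw [hn, Nat.mul_div_cancel_left _ (Nat.succ_pos m)]
  · intro l
    have h1 := hstep l
    have h2 := hWs l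
    have h3 := Nat.div_le_self (W l) (m + 1)
    have h4 := Nat.div_le_self (W (l + 1)) (m + 1)
    dsimp only
    omega

lemma spanMon_mul {K : Type*} [Field K] {A B C : Set (Fin n →₀ ℕ)}
    (h1 : ∀ u ∈ A, ∀ v ∈ B, u + v ∈ C) (h2 : ∀ w ∈ C, ∃ u ∈ A, ∃ v ∈ B, w = u + v) :
    spanMon K A * spanMon K B = spanMon K C := by
  rw [spanMon, spanMon, Ideal.span_mul_span']
  congr 1
  ext g
  simp only [Set.mem_mul, Set.mem_image]
  constructor
  · rintro ⟨_, ⟨u, hu, rfl⟩, _, ⟨v, hv, rfl⟩, rfl⟩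
    exact ⟨u + v, h1 u hu v hv, by rw [MvPolynomial.monomial_mul, one_mul]⟩
  · rintro ⟨w, hw, rfl⟩
    obtain ⟨u, hu, v, hv, rfl⟩ := h2 w hw
    exact ⟨_, ⟨u, hu, rfl⟩, _, ⟨v, hv, rfl⟩, by rw [MvPolynomial.monomial_mul, one_mul]⟩

/-- Powers of a right PLP-polymatroidal ideal are obtained by scaling the data. -/
theorem spanMon_pow {K : Type*} [Field K] (hκ : κ < n) (m : ℕ) :
    spanMon K (baseSet n κ d α β b) ^ (m + 1) =
      spanMon K (baseSet n κ ((m + 1) * d) (fun i => (m + 1) * α i) (fun i => (m + 1) * β i)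
        (fun i => (m + 1) * b i)) := by
  induction m with
  | zero => simp
  | succ m ih =>
    rw [pow_succ, ih]
    refine spanMon_mul (fun u hu v hv => ?_) fun w hw => ?_
    · have := (IsBase.add hu hv).congr hκ fun l _ => (ext_add u v l).symm
      have e : ∀ a, (m + 1 + 1) * a = (m + 1) * a + a := fun a => by ring
      simp only [e]
      exact this
    · obtain ⟨v, w', hv, hw', hsum⟩ := IsBase.exists_add hw
      refine ⟨expo n v, (expo_mem_baseSet hκ).2 hv, expo n w', (expo_mem_baseSet hκ).2 hw', ?_⟩
      ext i
      rw [Finsupp.add_apply, expo_apply, expo_apply, ← hsum, ext_apply]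

end Powers

/-! ### Passage from the given data to the normalised data -/

section Conversion

lemma sum_Iic_eq (u : Fin n → ℕ) (i : Fin n) :
    ∑ j ∈ Iic i, u j = ∑ x ∈ range (i + 1), ext u x := by
  refine sum_bij (fun j _ => (j : ℕ)) (fun j hj => ?_) (fun _ _ _ _ h => Fin.ext h)
    (fun x hx => ?_) fun j _ => (ext_apply u j).symm
  · have : j ≤ i := mem_Iic.1 hj
    exact mem_range.2 (by have := Fin.le_def.1 this; omega)
  · have := mem_range.1 hx
    exact ⟨⟨x, by omega⟩, mem_Iic.2 (Fin.le_def.2 (by simp; omega)), rfl⟩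

lemma sum_Ioi_eq (u : Fin n → ℕ) (i : Fin n) :
    ∑ j ∈ Ioi i, u j = ∑ x ∈ Ico ((i : ℕ) + 1) n, ext u x := by
  refine sum_bij (fun j _ => (j : ℕ)) (fun j hj => ?_) (fun _ _ _ _ h => Fin.ext h)
    (fun x hx => ?_) fun j _ => (ext_apply u j).symm
  · have : i < j := mem_Ioi.1 hj
    exact mem_Ico.2 ⟨by have := Fin.lt_def.1 this; omega, j.2⟩
  · have := mem_Ico.1 hx
    exact ⟨⟨x, by omega⟩, mem_Ioi.2 (Fin.lt_def.2 (by simp; omega)), rfl⟩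

variable {k : Fin n} {b α β : Fin n → ℕ}

/-- The lower bounds, with the one at `k` normalised. -/
def lowerBound (d : ℕ) (k : Fin n) (b α : Fin n → ℕ) : ℕ → ℕ := fun i =>
  -- The entries after k contribute at most b([k+1,n]), so every base satisfies the raised bound
  -- anyway. Raising it guarantees that any admissible left sum can be completed to degree d.
  if i = (k : ℕ) + 1 then max (α k) (d - ∑ j ∈ Ioi k, b j) else shift α i

lemma shift_succ (f : Fin n → ℕ) (i : Fin n) : shift f (i + 1) = f i := ext_apply f i

lemma shift_mono {f : Fin n → ℕ} (hf : Monotone f) {i j : ℕ} (hij : i ≤ j) (hj : j ≤ n) :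
    shift f i ≤ shift f j := by
  rcases i with _ | i
  · exact Nat.zero_le _
  rcases j with _ | j
  · omega
  · simp only [shift]
    rw [ext_of_lt f (by omega : i < n), ext_of_lt f (by omega : j < n)]
    exact hf (Fin.mk_le_mk.2 (by omega))

lemma data_of_isRightPLPType (h : IsRightPLPType n d k b α β) :
    Data n (k + 1) d (lowerBound d k b α) (shift β) (ext b) := by
  have hk := h.k_lt
  have hα : ∀ i, i ≤ (k : ℕ) + 1 → shift α i ≤ lowerBound d k b α i := fun i hi => by
    unfold lowerBound
    split_ifs with hik
    · rw [hik, shift_succ]; exact le_max_left _ _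
    · exact le_rfl
  have hβ : ∀ i : Fin n, β i ≤ d := fun i => by
    rw [← h.β_last ⟨n - 1, by omega⟩ (by simp; omega)]
    exact h.monotone_β (Fin.le_def.2 (by simp; omega))
  refine
  { κ_pos := Nat.succ_pos _
    κ_lt := hk
    d_pos := h.d_pos
    α_zero := by simp [lowerBound, shift]
    β_zero := rfl
    α_mono := fun i j hij hj => ?_
    β_mono := fun i j hij hj => shift_mono h.monotone_β hij (by omega)
    α_le := fun i hi => ?_
    β_one := ?_
    β_le := ?_
    b_pos := fun l h1 h2 => ?_
    d_le := ?_ }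
  · by_cases hi : i = (k : ℕ) + 1
    · have : j = i := by omega
      rw [this]
    · calc lowerBound d k b α i = shift α i := by simp [lowerBound, hi]
        _ ≤ shift α j := shift_mono h.monotone_α hij (by omega)
        _ ≤ _ := hα j hj
  · unfold lowerBound
    split_ifs with hik
    · rw [hik, shift_succ]
      have := h.α_le_β k
      have := h.d_le
      omega
    · rcases i with _ | i
      · simp [shift]
      · have hin : i < n := by omega
        exact (by simpa [shift, ext_of_lt _ hin] using h.α_le_β ⟨i, hin⟩)
  · have h0 : 0 < n := by omega
    have := h.β_pos ⟨0, h0⟩ (Fin.le_def.2 (Nat.zero_le _))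
    simpa [shift, ext_of_lt _ h0] using this
  · rw [shift_succ]; exact hβ k
  · rw [ext_of_lt _ h2]
    exact h.b_pos _ (Fin.lt_def.2 (by simp; omega))
  · rw [← sum_Ioi_eq]
    simp only [lowerBound, if_true]
    omega

/-- The remaining constraints are redundant: b_i ≥ d on the left says nothing beyond the total
degree, and on the right the prefix bounds α_k and d follow from the bound at k and the total. -/
lemma plpBases_eq (h : IsRightPLPType n d k b α β) :
    plpBases 0 b α β = baseSet n (k + 1) d (lowerBound d k b α) (shift β) (ext b) := by
  have hk := h.k_lt
  ext u
  have hlast : ∑ x ∈ range n, ext u x = ∑ j ∈ Iic (⟨n - 1, by omega⟩ : Fin n), u j := by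
    rw [sum_Iic_eq]; congr 2; simp; omega
  have hmono : ∀ i j, i ≤ j → ∑ x ∈ range i, ext u x ≤ ∑ x ∈ range j, ext u x := fun i j hij =>
    sum_le_sum_of_subset (range_mono hij)
  constructor
  · rintro ⟨h1, h2⟩
    have hsum : ∑ x ∈ range n, ext u x = d := by
      have h3 := h2 ⟨n - 1, by omega⟩
      rw [h.α_last _ (by simp; omega), h.β_last _ (by simp; omega), ← hlast] at h3
      omega
    refine ⟨fun i hi => ?_, fun i hi => ?_, fun l h3 h4 => ?_, hsum⟩
    · unfold lowerBound
      split_ifs with hik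
      · subst hik
        refine max_le ?_ ?_
        · rw [← sum_Iic_eq]; exact (h2 k).1
        · rw [tsub_le_iff_right, sum_Ioi_eq, ← hsum, ← sum_range_add_sum_Ico _ hk.le]
          refine Nat.add_le_add_left (sum_le_sum fun x hx => ?_) _
          have hx' := (mem_Ico.1 hx).2
          rw [ext_of_lt _ hx', ext_of_lt _ hx']
          exact (h1 _).2
      · rcases i with _ | i
        · simp [shift]
        · have hin : i < n := by omega
          have := (h2 ⟨i, hin⟩).1
          rw [sum_Iic_eq] at this
          simpa [shift, ext_of_lt _ hin] using this
    · rcases i with _ | i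
      · simp
      · have hin : i < n := by omega
        have := (h2 ⟨i, hin⟩).2
        rw [sum_Iic_eq] at this
        simpa [shift, ext_of_lt _ hin] using this
    · rw [ext_of_lt _ h4, ext_of_lt _ h4]
      exact (h1 _).2
  · intro hu
    have hle : ∀ i, i ≤ n → ∑ x ∈ range i, ext u x ≤ d := fun i hi => by
      rw [← hu.sum_eq]; exact hmono i n hi
    have hαk : α k ≤ ∑ x ∈ range (k + 1), ext u x := by
      have := hu.le_sum (k + 1) le_rfl
      simp only [lowerBound, if_true] at this
      exact (le_max_left _ _).trans this
    refine ⟨fun i => ⟨Nat.zero_le _, ?_⟩, fun i => ?_⟩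
    · by_cases hik : i ≤ k
      · refine le_trans ?_ (h.le_b i hik)
        refine le_trans ?_ (hle (i + 1) (by omega))
        rw [sum_range_succ, ext_apply]
        omega
      · have := hu.le_b i (by have := Fin.lt_def.1 (not_le.1 hik); omega) i.2
        rwa [ext_apply, ext_apply] at this
    · rw [sum_Iic_eq]
      by_cases hik : i < k
      · have hlt := Fin.lt_def.1 hik
        have h3 := hu.le_sum (i + 1) (by omega)
        have h4 := hu.sum_le (i + 1) (by omega)
        rw [shift_succ] at h4
        rw [lowerBound, if_neg (by omega), shift_succ] at h3
        exact ⟨h3, h4⟩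
      by_cases hik' : i = k
      · subst hik'
        have h4 := hu.sum_le (i + 1) le_rfl
        rw [shift_succ] at h4
        exact ⟨hαk, h4⟩
      · have hlt : k < i := lt_of_le_of_ne (not_lt.1 hik) (Ne.symm hik')
        have hlt' := Fin.lt_def.1 hlt
        by_cases hil : (i : ℕ) + 1 = n
        · rw [h.α_last i hil, h.β_last i hil, hil, hu.sum_eq]
          exact ⟨le_rfl, le_rfl⟩
        · rw [h.α_right i hlt (by omega), h.β_right i hlt (by omega)]
          exact ⟨hαk.trans (hmono _ _ (by omega)), hle _ (by omega)⟩

end Conversion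

end RightPLP

/-! ### Linear quotients of right PLP-polymatroidal ideals -/

namespace RightPLP

open Finset MonomialIdeal Koszul

variable {n κ d : ℕ} {α β b : ℕ → ℕ}

/-- With j the first index after p where u exceeds v, moving a unit from j to p raises exactly the
partial sums of length in (p, j]. There u stays strictly below v in partial sum, so the upper bounds
met by v survive. -/
lemma IsBase.exchange {u v : ℕ → ℕ} (hu : IsBase n κ d α β b u)
    (hv : IsBase n κ d α β b v) {p : ℕ} (hp : p < n) (heq : ∀ l, l < p → u l = v l)
    (hlt : u p < v p) :
    ∃ j, p < j ∧ j < n ∧ 0 < u j ∧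
      IsBase n κ d α β b (fun x => if x = p then u x + 1 else if x = j then u x - 1 else u x) := by
  have hUp : ∑ x ∈ range p, u x = ∑ x ∈ range p, v x :=
    sum_congr rfl fun x hx => heq x (mem_range.1 hx)
  have hex : ∃ j, p < j ∧ j < n ∧ v j < u j := by
    by_contra! hcon
    have : ∑ x ∈ range n, u x < ∑ x ∈ range n, v x := by
      refine sum_lt_sum (fun x hx => ?_) ⟨p, mem_range.2 hp, hlt⟩
      rcases lt_trichotomy x p with h | h | h
      · exact (heq x h).le
      · exact h ▸ hlt.le
      · exact hcon x h (mem_range.1 hx)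
    rw [hu.sum_eq, hv.sum_eq] at this
    exact lt_irrefl _ this
  classical
  let j := Nat.find hex
  obtain ⟨hpj, hjn, hj⟩ : p < j ∧ j < n ∧ v j < u j := Nat.find_spec hex
  have hmin : ∀ x, p < x → x < j → u x ≤ v x := fun x h1 h2 => by
    have := Nat.find_min hex h2
    by_contra h
    exact this ⟨h1, h2.trans hjn, not_le.1 h⟩
  have hV : ∀ i, p < i → i ≤ j → ∑ x ∈ range i, u x + 1 ≤ ∑ x ∈ range i, v x := by
    intro i hi
    induction i, (Nat.succ_le_of_lt hi) using Nat.le_induction with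
    | base => intro _; rw [sum_range_succ, sum_range_succ, hUp]; omega
    | succ i hi' ih =>
      intro hij
      rw [sum_range_succ, sum_range_succ]
      have := ih (by omega) (by omega)
      have := hmin i (by omega) (by omega)
      omega
  have hsum : ∀ i, ∑ x ∈ range i, (if x = p then u x + 1 else if x = j then u x - 1 else u x) =
      ∑ x ∈ range i, u x + if p < i ∧ i ≤ j then 1 else 0 := by
    intro i
    induction i with
    | zero => simp
    | succ i ih =>
      rw [sum_range_succ, sum_range_succ, ih]
      rcases lt_trichotomy i p with h | h | h
      · have := hpj
        rw [if_neg (by omega), if_neg (by omega), if_neg (by omega), if_neg (by omega), add_zero,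
          add_zero]
      · subst h
        rw [if_neg (by omega), if_pos rfl, if_pos (by omega)]; omega
      · rcases lt_trichotomy i j with h' | h' | h'
        · rw [if_pos (by omega), if_neg (by omega), if_neg (by omega), if_pos (by omega)]; omega
        · rw [if_pos (by omega), if_neg (by omega), if_pos h', if_neg (by omega)]
          rw [← h'] at hj
          omega
        · rw [if_neg (by omega), if_neg (by omega), if_neg (by omega), if_neg (by omega), add_zero,
            add_zero]
  refine ⟨j, hpj, hjn, by omega, fun i hi => ?_, fun i hi => ?_, fun l h1 h2 => ?_, ?_⟩
  · rw [hsum]; exact (hu.le_sum i hi).trans (Nat.le_add_right _ _)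
  · rw [hsum]
    split_ifs with h
    · exact (hV i h.1 h.2).trans (hv.sum_le i hi)
    · exact hu.sum_le i hi
  · have := hu.le_b l h1 h2
    split_ifs with h3 h4
    · subst h3
      have := hv.le_b l h1 h2
      omega
    · omega
    · exact this
  · rw [hsum, if_neg (by omega), hu.sum_eq, add_zero]

/-- The number of free indices left of `κ`. -/
def freeCount (κ : ℕ) (α β : ℕ → ℕ) : ℕ :=
  ((range (κ - 1)).filter fun l => α (l + 1) < β (l + 1)).card

/-- The contribution of the right part to the projective dimension. -/
def rightRank (n κ d : ℕ) (α β b : ℕ → ℕ) : ℕ :=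
  if α κ < β κ then min (n - κ) (β κ + ∑ l ∈ Ico κ n, b l - d)
  else if β κ < d then min (n - κ - 1) (β κ + ∑ l ∈ Ico κ n, b l - d) else 0

/-- An index below κ − 1 can occur only if it is free, and κ − 1 only if the left sum U is below β
κ. On the right each index wastes a unit of capacity, so there are at most U + Σ b − d of them, and
n − 1 is excluded. Gaining κ − 1 thus costs one unit of U, and the two effects combine to the
minimum in `rightRank`. -/
lemma IsBase.card_le (h : Data n κ d α β b) {u : ℕ → ℕ} (hu : IsBase n κ d α β b u) {G : Finset ℕ}
    (hG : ∀ l ∈ G, l < n ∧ (l < κ → ∑ x ∈ range (l + 1), u x < β (l + 1)) ∧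
      (κ ≤ l → u l < b l ∧ l + 1 < n ∧ (α κ = β κ → β κ < d))) :
    G.card ≤ freeCount κ α β + rightRank n κ d α β b := by
  have hκ := h.κ_pos
  have hκn := h.κ_lt
  set U := ∑ x ∈ range κ, u x with hU
  set Gₗ := G.filter (· < κ)
  set Gᵣ := G.filter (fun l => ¬ l < κ)
  have hcard : G.card = Gₗ.card + Gᵣ.card := (card_filter_add_card_filter_not _).symm
  have hUα : α κ ≤ U := hu.le_sum κ le_rfl
  have hUβ : U ≤ β κ := hu.sum_le κ le_rfl
  have hL : Gₗ.card ≤ freeCount κ α β + if U < β κ then 1 else 0 := by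
    have hsub : Gₗ ⊆ ((range (κ - 1)).filter fun l => α (l + 1) < β (l + 1)) ∪
        if U < β κ then {κ - 1} else ∅ := by
      intro l hl
      obtain ⟨hlG, hlκ⟩ := mem_filter.1 hl
      have h1 := (hG l hlG).2.1 hlκ
      by_cases hlast : l = κ - 1
      · rw [hlast, Nat.sub_add_cancel hκ] at h1
        rw [if_pos h1]
        simp [hlast]
      · refine mem_union_left _ (mem_filter.2 ⟨mem_range.2 (by omega), ?_⟩)
        exact (hu.le_sum (l + 1) (by omega)).trans_lt h1
    refine (card_le_card hsub).trans ((card_union_le _ _).trans ?_)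
    refine Nat.add_le_add le_rfl ?_
    split_ifs <;> simp
  have hRsub : Gᵣ ⊆ Ico κ (n - 1) := fun l hl => by
    obtain ⟨hlG, hlκ⟩ := mem_filter.1 hl
    have := (hG l hlG).2.2 (not_lt.1 hlκ)
    exact mem_Ico.2 ⟨not_lt.1 hlκ, by omega⟩
  have hR1 : Gᵣ.card ≤ n - κ - 1 := by
    refine (card_le_card hRsub).trans ?_
    rw [Nat.card_Ico]; omega
  have hR2 : Gᵣ.card + d ≤ U + ∑ l ∈ Ico κ n, b l := by
    have h1 : U + ∑ l ∈ Ico κ n, u l = d := by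
      rw [← hu.sum_eq, hU, sum_range_add_sum_Ico _ hκn.le]
    have h2 : Gᵣ.card + ∑ l ∈ Ico κ n, u l ≤ ∑ l ∈ Ico κ n, b l := by
      have h3 : Gᵣ.card = ∑ l ∈ Ico κ n, if l ∈ Gᵣ then 1 else 0 := by
        rw [sum_boole, filter_mem_eq_inter,
          inter_eq_right.2 (hRsub.trans (Ico_subset_Ico le_rfl (by omega)))]
        simp
      rw [h3, ← sum_add_distrib]
      refine sum_le_sum fun l hl => ?_
      obtain ⟨hl1, hl2⟩ := mem_Ico.1 hl
      have := hu.le_b l hl1 hl2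
      split_ifs with hlR
      · have := ((hG l (mem_filter.1 hlR).1).2.2 hl1).1
        omega
      · omega
    omega
  have hR3 : α κ = β κ → ¬ β κ < d → Gᵣ.card = 0 := fun h1 h2 => by
    rw [card_eq_zero, eq_empty_iff_forall_notMem]
    intro l hl
    obtain ⟨hlG, hlκ⟩ := mem_filter.1 hl
    exact h2 (((hG l hlG).2.2 (not_lt.1 hlκ)).2.2 h1)
  have hαβ := h.α_le κ le_rfl
  unfold rightRank
  split_ifs at hL ⊢ <;> omega

lemma baseSet_finite : (baseSet n κ d α β b).Finite := by
  refine (Set.finite_Iic (expo n fun _ => d)).subset fun u hu i => ?_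
  rw [expo_apply, ← ext_apply (u : Fin n → ℕ) i, ← hu.sum_eq]
  exact single_le_sum (f := ext u) (fun _ _ => Nat.zero_le _) (mem_range.2 i.2)

lemma apply_le_of_mem_baseSet {u : Fin n →₀ ℕ} (hu : u ∈ baseSet n κ d α β b) (i : Fin n) :
    u i ≤ d := by
  rw [← ext_apply (u : Fin n → ℕ) i, ← hu.sum_eq]
  exact single_le_sum (f := ext u) (fun _ _ => Nat.zero_le _) (mem_range.2 i.2)

lemma sum_range_ext (u : Fin n → ℕ) : ∑ x ∈ range n, ext u x = ∑ i, u i := by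
  rw [← Fin.sum_univ_eq_sum_range]
  exact sum_congr rfl fun i _ => ext_apply u i

lemma degree_of_mem_baseSet {u : Fin n →₀ ℕ} (hu : u ∈ baseSet n κ d α β b) : u.degree = d := by
  rw [Finsupp.degree_eq_sum, ← sum_range_ext, hu.sum_eq]

lemma lex_lt_of_le_add_single {u v : Fin n →₀ ℕ} {l : Fin n} (hlt : toLex u < toLex v)
    (hle : v ≤ u + Finsupp.single l 1) : (∀ i, i < l → u i = v i) ∧ v l = u l + 1 := by
  obtain ⟨p, hp, hpv⟩ := Finsupp.Lex.lt_iff.1 hlt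
  simp only [ofLex_toLex] at hp hpv
  have h1 := hle p
  rw [Finsupp.add_apply, Finsupp.single_apply] at h1
  have hpl : l = p := by
    by_contra hne
    rw [if_neg hne] at h1
    omega
  subst hpl
  rw [if_pos rfl] at h1
  exact ⟨hp, by omega⟩

/-- Upper bound for the projective dimension. -/
theorem van_of_data {K : Type*} [Field K] (h : Data n κ d α β b) {i : ℕ}
    (hi : freeCount κ α β + rightRank n κ d α β b + 1 < i) :
    Van (vars K n) (MvPolynomial (Fin n) K ⧸ spanMon K (baseSet n κ d α β b)) i := by
  classical
  have hκn := h.κ_lt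
  rw [← baseSet_finite.coe_toFinset]
  refine van_of_linear_quotients
    -- G u consists of the variables l for which x_l x^u is divisible by a lex-larger generator;
    -- `IsBase.exchange` shows that they suffice.
    (G := fun u => univ.filter fun l => ∃ v ∈ baseSet n κ d α β b, toLex u < toLex v ∧
      v ≤ u + Finsupp.single l 1) (q := freeCount κ α β + rightRank n κ d α β b) ?_ ?_ ?_ hi
  · intro u hu
    have hu' : u ∈ baseSet n κ d α β b := by simpa using hu
    rw [← card_map Fin.valEmbedding]
    refine IsBase.card_le h hu' fun l hl => ?_
    obtain ⟨l, hl', rfl⟩ := mem_map.1 hl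
    obtain ⟨v, hv, hlt, hle⟩ := (mem_filter.1 hl').2
    obtain ⟨h1, h2⟩ := lex_lt_of_le_add_single hlt hle
    have hV : ∑ x ∈ range ((l : ℕ) + 1), ext v x = ∑ x ∈ range ((l : ℕ) + 1), ext u x + 1 := by
      rw [sum_range_succ, sum_range_succ, ext_apply, ext_apply, h2, ← add_assoc]
      congr 2
      refine sum_congr rfl fun x hx => ?_
      have hx' := mem_range.1 hx
      rw [ext_of_lt _ (hx'.trans l.2), ext_of_lt _ (hx'.trans l.2)]
      exact (h1 _ (Fin.lt_def.2 hx')).symm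
    refine ⟨l.2, fun hlκ => ?_, fun hlκ => ⟨?_, ?_, fun hαβ => ?_⟩⟩
    · have := hv.sum_le (l + 1) hlκ
      simp only [Fin.valEmbedding_apply]
      omega
    · have := hv.le_b l hlκ l.2
      rw [ext_apply, h2] at this
      simp only [Fin.valEmbedding_apply]
      rw [ext_apply]
      omega
    -- The last variable never occurs, as the total degree of u and v is the same.
    · have hln := l.2
      simp only [Fin.valEmbedding_apply]
      by_contra hcon
      have hln' : (l : ℕ) + 1 = n := by omega
      rw [hln', hv.sum_eq, hu'.sum_eq] at hV
      omega
    · simp only [Fin.valEmbedding_apply] at hlκ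
      have h3 : ∑ x ∈ range κ, ext u x ≤ ∑ x ∈ range ((l : ℕ) + 1), ext u x :=
        sum_le_sum_of_subset (range_mono (by omega))
      have h4 := hu'.le_sum κ le_rfl
      have h5 : ∑ x ∈ range ((l : ℕ) + 1), ext v x ≤ ∑ x ∈ range n, ext v x :=
        sum_le_sum_of_subset (range_mono l.2)
      rw [hv.sum_eq] at h5
      omega
  · intro u hu v hv hlt
    have hu' : u ∈ baseSet n κ d α β b := by simpa using hu
    have hv' : v ∈ baseSet n κ d α β b := by simpa using hv
    obtain ⟨p, hp, hpv⟩ := Finsupp.Lex.lt_iff.1 hlt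
    simp only [ofLex_toLex] at hp hpv
    obtain ⟨j, hpj, hjn, hj, hbase⟩ := IsBase.exchange hu' hv' p.2
      (fun l hl => by
        rw [ext_of_lt _ (hl.trans p.2), ext_of_lt _ (hl.trans p.2)]
        exact hp _ (Fin.lt_def.2 hl))
      (by rw [ext_apply, ext_apply]; exact hpv)
    refine ⟨p, mem_filter.2 ⟨mem_univ _, _, (expo_mem_baseSet hκn).2 hbase, ?_, fun i => ?_⟩, hpv⟩
    · refine Finsupp.Lex.lt_iff.2 ⟨p, fun i hi => ?_, ?_⟩
      · have hi' := Fin.lt_def.1 hi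
        simp only [ofLex_toLex]
        rw [expo_apply, if_neg (by omega), if_neg (by omega), ext_apply]
      · simp only [ofLex_toLex]
        rw [expo_apply, if_pos rfl, ext_apply]
        exact Nat.lt_succ_self _
    · rw [expo_apply, Finsupp.add_apply, Finsupp.single_apply, ext_apply]
      by_cases hip : p = i
      · simp [hip]
      · have : (i : ℕ) ≠ p := fun h => hip (Fin.ext h.symm)
        rw [if_neg this, if_neg hip]
        split_ifs <;> omega
  · intro u _ l hl
    obtain ⟨v, hv, h1, h2⟩ := (mem_filter.1 hl).2
    exact ⟨v, by simpa using hv, h1, h2⟩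

end RightPLP

/-! ### Nonvanishing Koszul homology of right PLP-polymatroidal ideals -/

namespace RightPLP

open Finset MonomialIdeal Koszul MvPolynomial

variable {n κ d : ℕ} {α β b : ℕ → ℕ} {K : Type*} [Field K]

lemma exists_le_sum_eq (f : ℕ → ℕ) (s : Finset ℕ) {t : ℕ} (ht : t ≤ ∑ x ∈ s, f x) :
    ∃ g : ℕ → ℕ, (∀ x, g x ≤ f x) ∧ ∑ x ∈ s, g x = t := by
  induction s using Finset.induction_on generalizing t with
  | empty => exact ⟨fun _ => 0, fun _ => Nat.zero_le _, by simpa using (Nat.le_zero.1 ht).symm⟩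
  | insert a s ha ih =>
    rw [sum_insert ha] at ht
    obtain ⟨g, hg, hsum⟩ := ih (t := t - f a) (by omega)
    refine ⟨Function.update g a (min (f a) t), fun x => ?_, ?_⟩
    · by_cases hx : x = a
      · subst hx; simp
      · simp [hx, hg]
    · rw [sum_insert ha, Function.update_self]
      have : ∑ x ∈ s, Function.update g a (min (f a) t) x = ∑ x ∈ s, g x :=
        sum_congr rfl fun x hx => by
          rw [Function.update_of_ne]; rintro rfl; exact ha hx
      rw [this, hsum]
      omega

/-- Exponent vectors in the first `i` variables of degree `c` satisfying the constraints that
concern these variables. -/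
def partialSet (n κ : ℕ) (α β b : ℕ → ℕ) (i c : ℕ) : Set (Fin n →₀ ℕ) :=
  {m | (∀ l : Fin n, i ≤ l → m l = 0) ∧
    (∀ j, j ≤ κ → j ≤ i → α j ≤ ∑ x ∈ range j, ext m x ∧ ∑ x ∈ range j, ext m x ≤ β j) ∧
    (∀ l, κ ≤ l → l < i → ext m l ≤ b l) ∧ ∑ x ∈ range i, ext m x = c}

lemma ext_single (l : Fin n) (a x : ℕ) :
    ext (Finsupp.single l a : Fin n →₀ ℕ) x = if x = l then a else 0 := by
  unfold ext
  split_ifs with h1 h2 h2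
  · subst h2; simp
  · rw [Finsupp.single_apply, if_neg]
    rintro rfl; exact h2 rfl
  · exact absurd (h2 ▸ l.2) h1
  · rfl

lemma sum_range_ext_add_single (m : Fin n →₀ ℕ) (l : Fin n) (a i : ℕ) :
    ∑ x ∈ range i, ext (m + Finsupp.single l a : Fin n →₀ ℕ) x =
      ∑ x ∈ range i, ext m x + if (l : ℕ) < i then a else 0 := by
  simp only [ext_add, sum_add_distrib, ext_single]
  rw [sum_ite_eq']
  simp

lemma add_single_mem_partialSet {i c a : ℕ} {l : Fin n} (hl : (l : ℕ) = i) {m : Fin n →₀ ℕ}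
    (hm : m ∈ partialSet n κ α β b i c)
    (h1 : i < κ → α (i + 1) ≤ c + a ∧ c + a ≤ β (i + 1)) (h2 : κ ≤ i → a ≤ b i) :
    m + Finsupp.single l a ∈ partialSet n κ α β b (i + 1) (c + a) := by
  obtain ⟨hz, hs, hb, hc⟩ := hm
  have hil : ext m i = 0 := by
    rw [← hl, ext_apply]; exact hz l hl.ge
  have hlast : ∑ x ∈ range (i + 1), ext (m + Finsupp.single l a : Fin n →₀ ℕ) x = c + a := by
    rw [sum_range_ext_add_single, if_pos (by omega), sum_range_succ, hc, hil, add_zero]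
  refine ⟨fun l' hl' => ?_, fun j hjκ hj => ?_, fun x hx1 hx2 => ?_, hlast⟩
  · rw [Finsupp.add_apply, hz l' (by omega), Finsupp.single_apply, if_neg (by rintro rfl; omega),
      add_zero]
  · rcases Nat.lt_or_ge i j with h | h
    · have hj' : j = i + 1 := by omega
      subst hj'
      rw [hlast]
      exact h1 (by omega)
    · rw [sum_range_ext_add_single, if_neg (by omega), add_zero]
      exact hs j hjκ h
  · rw [ext_add, ext_single]
    split_ifs with h
    · have hx : x = i := by omega
      subst hx
      rw [hil, zero_add]
      exact h2 hx1
    · rw [add_zero]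
      exact hb x hx1 (by omega)

lemma partialSet_subset_baseSet {i : ℕ} (hκi : κ ≤ i) (hin : i ≤ n) :
    partialSet n κ α β b i d ⊆ baseSet n κ d α β b := by
  rintro m ⟨hz, hs, hb, hc⟩
  have hz' : ∀ x, i ≤ x → ext m x = 0 := fun x hx => by
    unfold ext
    split_ifs with h
    · exact hz ⟨x, h⟩ hx
    · rfl
  refine ⟨fun j hj => (hs j hj (by omega)).1, fun j hj => (hs j hj (by omega)).2,
    fun l h1 _ => ?_, ?_⟩
  · rcases Nat.lt_or_ge l i with h | h
    · exact hb l h1 h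
    · rw [hz' l h]; exact Nat.zero_le _
  · rw [← sum_range_add_sum_Ico _ hin, hc,
      sum_eq_zero fun x hx => hz' x (mem_Ico.1 hx).1, add_zero]

lemma monomial_mul_mem_restrictSupport {A B : Set (Fin n →₀ ℕ)} {s : Fin n →₀ ℕ}
    (h : ∀ m ∈ A, m + s ∈ B) {g : MvPolynomial (Fin n) K} (hg : g ∈ restrictSupport K A) :
    monomial s (1 : K) * g ∈ restrictSupport K B := by
  rw [mem_restrictSupport_iff] at hg ⊢
  intro m hm
  rw [mem_coe, mem_support_iff, coeff_monomial_mul', one_mul] at hm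
  split_ifs at hm with hle
  · have := h _ (hg (mem_support_iff.2 hm))
    rwa [tsub_add_cancel_of_le hle] at this
  · exact absurd rfl hm

/-- A Koszul chain on the first `i` variables, of homological degree `p`, whose coefficients and
whose boundary have controlled support. -/
structure Chain (κ : ℕ) (α β b : ℕ → ℕ) (i c p : ℕ)
    (E : Finset (Fin n) → MvPolynomial (Fin n) K) : Prop where
  supp : Supp E p
  low : ∀ (A : Finset (Fin n)) (l : Fin n), l ∈ A → i ≤ (l : ℕ) → E A = 0
  ne : E ≠ 0
  mem : ∀ A, E A ∈ restrictSupport K (partialSet n κ α β b i c)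
  diff_mem : ∀ A, Koszul.diff (vars K n) E A ∈ restrictSupport K (partialSet n κ α β b i (c + 1))

lemma wedge_mem {l : Fin n} {E : Finset (Fin n) → MvPolynomial (Fin n) K}
    {V : Submodule K (MvPolynomial (Fin n) K)} (h : ∀ A, E A ∈ V) (A : Finset (Fin n)) :
    wedge l E A ∈ V := by
  unfold wedge
  split_ifs
  · exact zsmul_mem (h _) _
  · exact zero_mem _

lemma diff_low {i : ℕ} {E : Finset (Fin n) → MvPolynomial (Fin n) K}
    (h : ∀ (A : Finset (Fin n)) (l : Fin n), l ∈ A → i ≤ (l : ℕ) → E A = 0) (A : Finset (Fin n)) (l : Fin n) (hl : l ∈ A)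
    (hi : i ≤ (l : ℕ)) : Koszul.diff (vars K n) E A = 0 := by
  refine sum_eq_zero fun m _ => ?_
  unfold contr
  split_ifs
  · exact smul_zero _
  · rw [h _ l (mem_insert_of_mem hl) hi, smul_zero, smul_zero]

/-- The exterior multiplication step. -/
lemma Chain.wedge {i c p a : ℕ} {l : Fin n} (hl : (l : ℕ) = i)
    {E : Finset (Fin n) → MvPolynomial (Fin n) K} (hE : Chain κ α β b i c p E)
    (h1 : i < κ → α (i + 1) ≤ c + a + 1 ∧ c + a + 1 ≤ β (i + 1)) (h2 : κ ≤ i → a + 1 ≤ b i) :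
    ∃ E' : Finset (Fin n) → MvPolynomial (Fin n) K, Supp E' (p + 1) ∧
      (∀ (A : Finset (Fin n)) (l : Fin n), l ∈ A → i + 1 ≤ (l : ℕ) → E' A = 0) ∧ E' ≠ 0 ∧
      Koszul.diff (vars K n) E' ≠ 0 ∧
      (∀ A, Koszul.diff (vars K n) E' A ∈
        restrictSupport K (partialSet n κ α β b (i + 1) (c + a + 1))) ∧
      ((i < κ → α (i + 1) ≤ c + a) →
        ∀ A, E' A ∈ restrictSupport K (partialSet n κ α β b (i + 1) (c + a))) := by
  obtain ⟨A, hA⟩ : ∃ A, E A ≠ 0 := by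
    by_contra! h
    exact hE.ne (funext h)
  have hlA : l ∉ A := fun h => hA (hE.low A l h hl.ge)
  have hmon : monomial (Finsupp.single l a) (1 : K) ≠ 0 := by simp
  -- Both terms have degree c + a + 1: x_l^(a+1) E, and x_l^a times the wedge of ∂E. Only the first
  -- one is visible at index sets without l, so the boundary does not vanish.
  have hdiff : Koszul.diff (vars K n) (monomial (Finsupp.single l a) (1 : K) • Koszul.wedge l E) =
      monomial (Finsupp.single l a) (1 : K) •
        ((X l : MvPolynomial (Fin n) K) • E - Koszul.wedge l (Koszul.diff (vars K n) E)) := by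
    rw [diff_smul, diff_wedge]
  refine ⟨monomial (Finsupp.single l a) (1 : K) • Koszul.wedge l E, (hE.supp.wedge l).smul _,
    fun A' l' hl' hi => ?_, fun h => ?_, fun h => ?_, fun A' => ?_, fun h3 A' => ?_⟩
  · have hne : l' ≠ l := by rintro rfl; omega
    rw [Pi.smul_apply, Koszul.wedge]
    split_ifs
    · rw [hE.low (A'.erase l) l' (mem_erase.2 ⟨hne, hl'⟩) (by omega), smul_zero, smul_zero]
    · exact smul_zero _
  · have := congrFun h (insert l A)
    rw [Pi.smul_apply, Koszul.wedge, if_pos (mem_insert_self _ _), erase_insert hlA, smul_eq_mul,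
      Pi.zero_apply, mul_eq_zero] at this
    exact hA (sgn_smul_eq_zero.1 (this.resolve_left hmon))
  · rw [hdiff] at h
    have := congrFun h A
    rw [Pi.smul_apply, Pi.sub_apply, Koszul.wedge, if_neg hlA, sub_zero, Pi.smul_apply,
      smul_eq_mul, smul_eq_mul, Pi.zero_apply, mul_eq_zero, mul_eq_zero] at this
    exact hA ((this.resolve_left hmon).resolve_left (X_ne_zero l))
  · rw [hdiff, Pi.smul_apply, Pi.sub_apply, Pi.smul_apply, smul_eq_mul, smul_eq_mul, mul_sub]
    refine Submodule.sub_mem _ ?_ ?_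
    · rw [X, ← mul_assoc, monomial_mul, one_mul, ← Finsupp.single_add]
      refine monomial_mul_mem_restrictSupport (fun m hm => ?_) (hE.mem A')
      have := add_single_mem_partialSet (a := a + 1) hl hm (fun h => by have := h1 h; omega)
        (fun h => h2 h)
      rwa [← add_assoc] at this
    · refine monomial_mul_mem_restrictSupport (fun m hm => ?_) (wedge_mem hE.diff_mem A')
      have := add_single_mem_partialSet (a := a) hl hm (fun h => by have := h1 h; omega)
        (fun h => by have := h2 h; omega)
      rwa [add_right_comm] at this
  · rw [Pi.smul_apply, smul_eq_mul]
    refine monomial_mul_mem_restrictSupport (fun m hm => ?_) (wedge_mem hE.mem A')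
    exact add_single_mem_partialSet hl hm (fun h => ⟨h3 h, by have := h1 h; omega⟩)
      (fun h => by have := h2 h; omega)

/-- The multiplication step. -/
lemma Chain.mul {i c p a : ℕ} {l : Fin n} (hl : (l : ℕ) = i)
    {E : Finset (Fin n) → MvPolynomial (Fin n) K} (hE : Chain κ α β b i c p E)
    (h1 : i < κ → α (i + 1) ≤ c + a ∧ c + a ≤ β (i + 1))
    (h1' : Koszul.diff (vars K n) E = 0 ∨ (i < κ → c + a + 1 ≤ β (i + 1)))
    (h2 : κ ≤ i → a ≤ b i) :
    Chain κ α β b (i + 1) (c + a) p (monomial (Finsupp.single l a) (1 : K) • E) := by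
  refine ⟨hE.supp.smul _, fun A l' hl' hi => ?_, ?_, fun A => ?_, fun A => ?_⟩
  · rw [Pi.smul_apply, hE.low A l' hl' (by omega), smul_zero]
  · exact smul_ne_zero (monomial_eq_zero.not.2 one_ne_zero) hE.ne
  · rw [Pi.smul_apply, smul_eq_mul]
    exact monomial_mul_mem_restrictSupport (fun m hm => add_single_mem_partialSet hl hm h1 h2)
      (hE.mem A)
  · rw [diff_smul, Pi.smul_apply, smul_eq_mul]
    rcases h1' with h0 | h1'
    · rw [h0, Pi.zero_apply, mul_zero]; exact zero_mem _
    · refine monomial_mul_mem_restrictSupport (fun m hm => ?_) (hE.diff_mem A)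
      have := add_single_mem_partialSet (a := a) hl hm
        (fun h => by have := h1 h; have := h1' h; omega) h2
      rwa [add_right_comm] at this

/-- The number of free indices among the first `i`. -/
def free (α β : ℕ → ℕ) (i : ℕ) : ℕ := ((range i).filter fun l => α (l + 1) < β (l + 1)).card

lemma free_succ (α β : ℕ → ℕ) (i : ℕ) :
    free α β (i + 1) = free α β i + if α (i + 1) < β (i + 1) then 1 else 0 := by
  unfold free
  rw [range_add_one, filter_insert]
  split_ifs with h
  · rw [card_insert_of_notMem (by simp)]
  · simp

lemma chain_zero (h : Data n κ d α β b) :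
    Chain κ α β b 0 0 0 (fun A : Finset (Fin n) => if A = ∅ then (1 : MvPolynomial (Fin n) K) else 0) ∧
      Koszul.diff (vars K n)
        (fun A : Finset (Fin n) => if A = ∅ then (1 : MvPolynomial (Fin n) K) else 0) = 0 := by
  have h0 : Koszul.diff (vars K n)
      (fun A : Finset (Fin n) => if A = ∅ then (1 : MvPolynomial (Fin n) K) else 0) = 0 := by
    funext A
    refine sum_eq_zero fun m _ => ?_
    unfold contr
    split_ifs <;> simp_all
  refine ⟨⟨fun A hA => if_neg ?_, fun A l hl _ => if_neg ?_, fun h => ?_, fun A => ?_, fun A => ?_⟩,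
    h0⟩
  · rintro rfl; exact hA rfl
  · rintro rfl; exact absurd hl (notMem_empty l)
  · have := congrFun h ∅
    simp at this
  · split_ifs
    · rw [mem_restrictSupport_iff, support_one, coe_singleton, Set.singleton_subset_iff]
      refine ⟨fun _ _ => rfl, fun j _ hj => ?_, fun l _ hl => absurd hl (Nat.not_lt_zero l), by simp⟩
      have : j = 0 := by omega
      subst this
      simp [h.α_zero]
    · exact zero_mem _
  · rw [h0]; exact zero_mem _

/-- Each free index raises the homological degree by one through a wedge, always starting from the
smallest previous degree α i to leave the most room. At a tight index, where α = β, the boundary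
must not exceed the prescribed degree, so the chain itself is a cycle; it is kept as a boundary for
the case where the left part already has degree d. -/
lemma exists_chain_left (h : Data n κ d α β b) (i : ℕ) (hi : i ≤ κ) (c : ℕ) (hαc : α i ≤ c)
    (hcβ : c < β i ∨ c = β i ∧ α i = β i) :
    ∃ E : Finset (Fin n) → MvPolynomial (Fin n) K, Chain κ α β b i c (free α β i) E ∧
      (c < β i → Koszul.diff (vars K n) E ≠ 0) ∧
      (c = β i → Koszul.diff (vars K n) E = 0 ∧ (0 < i → ∃ E₀ : Finset (Fin n) → _,
        Supp E₀ (free α β i + 1) ∧ Koszul.diff (vars K n) E₀ = E)) := by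
  have hκn := h.κ_lt
  induction i generalizing c with
  | zero =>
    rw [h.α_zero, h.β_zero] at hcβ
    have hc : c = 0 := by omega
    subst hc
    obtain ⟨h1, h2⟩ := chain_zero (K := K) h
    refine ⟨_, by simpa [free] using h1, fun h0 => ?_, fun _ => ⟨h2, fun h => absurd h (lt_irrefl _)⟩⟩
    rw [h.β_zero] at h0
    exact absurd h0 (lt_irrefl _)
  | succ i ih =>
    have hle := h.α_le i (by omega)
    have hα := h.α_mono i (i + 1) (by omega) hi
    have hβ := h.β_mono i (i + 1) (by omega) hi
    obtain ⟨E, hE, hE1, hE2⟩ := ih (by omega) (α i) le_rfl (by omega)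
    let l : Fin n := ⟨i, by omega⟩
    have hl : (l : ℕ) = i := rfl
    rw [free_succ]
    rcases hcβ with hlt | ⟨hceq, htie⟩
    · rw [if_pos (by omega)]
      obtain ⟨E', s1, s2, s3, s4, s5, s6⟩ := hE.wedge (a := c - α i) hl (fun _ => by omega)
        (fun h => by omega)
      have hc : α i + (c - α i) = c := by omega
      rw [hc] at s5 s6
      exact ⟨E', ⟨s1, s2, s3, s6 (fun _ => hαc), s5⟩, fun _ => s4, fun h => by omega⟩
    · rw [if_neg (by omega), add_zero]
      by_cases hloop : α i = β (i + 1)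
      · have hz := hE2 (by omega)
        have hmul := hE.mul (a := 0) hl (fun _ => by omega) (Or.inl hz.1) (fun _ => Nat.zero_le _)
        have e1 : monomial (Finsupp.single l 0) (1 : K) • E = E := by simp
        have e2 : α i + 0 = c := by omega
        rw [e1, e2] at hmul
        refine ⟨E, hmul, fun h => by omega, fun _ => ⟨hz.1, fun _ => hz.2 ?_⟩⟩
        by_contra h0
        have h0' : i = 0 := by omega
        subst h0'
        have := h.β_one
        rw [h.α_zero] at hloop
        simp only [zero_add] at hloop
        omega
      -- The wedge is formed one degree lower, so that its boundary has degree c; the boundary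
      -- becomes the new chain.
      · obtain ⟨E', s1, s2, s3, s4, s5, s6⟩ := hE.wedge (a := c - 1 - α i) hl (fun _ => by omega)
          (fun h => by omega)
        have hc : α i + (c - 1 - α i) + 1 = c := by omega
        rw [hc] at s5
        refine ⟨Koszul.diff (vars K n) E', ⟨s1.diff, diff_low s2, s4, s5, fun A => ?_⟩,
          fun h => by omega, fun _ => ⟨diff_diff _ _, fun _ => ⟨E', s1, rfl⟩⟩⟩
        rw [diff_diff]
        exact zero_mem _

/-- The first τ right variables are wedged in and need w l < b l, since the boundary contains x_l^(w
l + 1). The others only multiply, and may be filled up to b l. -/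
lemma exists_chain_right {c p τ : ℕ} {w : ℕ → ℕ} (hτ : 0 < τ)
    (hw : ∀ l, κ ≤ l → l < n → w l ≤ b l) (hw' : ∀ l, κ ≤ l → l < κ + τ → w l < b l)
    {E : Finset (Fin n) → MvPolynomial (Fin n) K} (hE : Chain κ α β b κ c p E) (i : ℕ)
    (hκi : κ ≤ i) (hi : i ≤ n) :
    ∃ E : Finset (Fin n) → MvPolynomial (Fin n) K,
      Chain κ α β b i (c + ∑ x ∈ Ico κ i, w x) (p + min (i - κ) τ) E ∧
        (κ < i → Koszul.diff (vars K n) E ≠ 0) := by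
  induction i, hκi using Nat.le_induction with
  | base => exact ⟨E, by simpa using hE, fun h => absurd h (lt_irrefl _)⟩
  | succ i hκi ih =>
    obtain ⟨E, hE, hE1⟩ := ih (by omega)
    let l : Fin n := ⟨i, by omega⟩
    have hl : (l : ℕ) = i := rfl
    rw [sum_Ico_succ_top hκi, ← add_assoc]
    by_cases hiτ : i < κ + τ
    · obtain ⟨E', s1, s2, s3, s4, s5, s6⟩ := hE.wedge (a := w i) hl (fun h => by omega)
        (fun _ => hw' i hκi hiτ)
      refine ⟨E', ⟨?_, s2, s3, s6 (fun h => by omega), s5⟩, fun _ => s4⟩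
      have : p + min (i + 1 - κ) τ = p + min (i - κ) τ + 1 := by omega
      rwa [this]
    · have hmul := hE.mul (a := w i) hl (fun h => by omega) (Or.inr fun h => by omega)
        (fun _ => hw i hκi (by omega))
      refine ⟨monomial (Finsupp.single l (w i)) (1 : K) • E, ?_, fun _ => ?_⟩
      · have : p + min (i + 1 - κ) τ = p + min (i - κ) τ := by omega
        rw [this]
        exact hmul
      · rw [diff_smul]
        exact smul_ne_zero (monomial_eq_zero.not.2 one_ne_zero) (hE1 (by omega))

lemma not_van_of_chain {p i : ℕ} (hκi : κ ≤ i) (hin : i ≤ n)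
    {E : Finset (Fin n) → MvPolynomial (Fin n) K} (hs : Supp E p)
    (h0 : Koszul.diff (vars K n) E ≠ 0)
    (hmem : ∀ A, Koszul.diff (vars K n) E A ∈ restrictSupport K (partialSet n κ α β b i d)) :
    ¬ Van (vars K n) (MvPolynomial (Fin n) K ⧸ spanMon K (baseSet n κ d α β b)) p := by
  have hsub := partialSet_subset_baseSet (α := α) (β := β) (b := b) (d := d) hκi hin
  refine not_van_of_linear (fun u hu => degree_of_mem_baseSet hu) hs (fun A => ?_)
    (fun A m hm => ?_) h0
  · rw [mem_ideal_span_monomial_image]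
    exact fun m hm => ⟨m, hsub ((mem_restrictSupport_iff K).1 (hmem A) hm), le_rfl⟩
  · exact degree_of_mem_baseSet (hsub ((mem_restrictSupport_iff K).1 (hmem A) hm))

lemma free_eq (h : Data n κ d α β b) :
    free α β κ = freeCount κ α β + if α κ < β κ then 1 else 0 := by
  obtain ⟨j, rfl⟩ : ∃ j, κ = j + 1 := ⟨κ - 1, by have := h.κ_pos; omega⟩
  rw [free_succ]; rfl

lemma card_le_sum_b (h : Data n κ d α β b) {τ : ℕ} (hτ : κ + τ ≤ n) :
    τ + ∑ x ∈ Ico κ (κ + τ), (b x - 1) = ∑ x ∈ Ico κ (κ + τ), b x := by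
  have h1 : τ = ∑ x ∈ Ico κ (κ + τ), 1 := by simp
  conv_lhs => rw [h1]
  have h2 : κ + ∑ x ∈ Ico κ (κ + τ), 1 = κ + τ := by rw [← h1]
  rw [h2, ← sum_add_distrib]
  refine sum_congr rfl fun x hx => ?_
  obtain ⟨h3, h4⟩ := mem_Ico.1 hx
  have := h.b_pos x h3 (by omega)
  omega

/-- Here c is the degree of the left part, s the total exponent on the τ wedged right variables, and
the other right variables are saturated. The degree is d − 1, so the boundary has its coefficients
supported on bases. -/
lemma not_van_of_choice (h : Data n κ d α β b) {c τ s : ℕ} (hτ : 0 < τ) (hτn : κ + τ ≤ n)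
    (hαc : α κ ≤ c) (hcβ : c < β κ ∨ c = β κ ∧ α κ = β κ)
    (hs : s ≤ ∑ x ∈ Ico κ (κ + τ), (b x - 1))
    (hsum : c + s + ∑ x ∈ Ico (κ + τ) n, b x + 1 = d) :
    ¬ Van (vars K n) (MvPolynomial (Fin n) K ⧸ spanMon K (baseSet n κ d α β b))
      (free α β κ + τ) := by
  obtain ⟨E, hE, -, -⟩ := exists_chain_left (K := K) h κ le_rfl c hαc hcβ
  obtain ⟨g, hg, hgs⟩ := exists_le_sum_eq (fun x => b x - 1) _ hs
  have hκn := h.κ_lt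
  let w : ℕ → ℕ := fun x => if x < κ + τ then g x else b x
  have hwsum : ∑ x ∈ Ico κ n, w x = s + ∑ x ∈ Ico (κ + τ) n, b x := by
    rw [← sum_Ico_consecutive _ (by omega : κ ≤ κ + τ) hτn, ← hgs]
    congr 1
    · exact sum_congr rfl fun x hx => if_pos (mem_Ico.1 hx).2
    · exact sum_congr rfl fun x hx => if_neg (by have := mem_Ico.1 hx; omega)
  obtain ⟨E', hE', hne⟩ := exists_chain_right (w := w) hτ (fun l h1 h2 => by
      dsimp only [w]
      have := hg l
      split_ifs <;> omega) (fun l h1 h2 => by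
      dsimp only [w]
      have := hg l
      have := h.b_pos l h1 (by omega)
      rw [if_pos h2]; omega) hE n hκn.le le_rfl
  rw [hwsum, min_eq_right (by omega)] at hE'
  refine not_van_of_chain hκn.le le_rfl hE'.supp (hne hκn) fun A => ?_
  have := hE'.diff_mem A
  rwa [← add_assoc, hsum] at this

/-- Lower bound for the projective dimension. -/
theorem not_van_of_data (h : Data n κ d α β b) :
    ¬ Van (vars K n) (MvPolynomial (Fin n) K ⧸ spanMon K (baseSet n κ d α β b))
      (freeCount κ α β + rightRank n κ d α β b + 1) := by
  have hκn := h.κ_lt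
  have hαβ := h.α_le κ le_rfl
  have hβd := h.β_le
  have hdB := h.d_le
  have hfree := free_eq h
  set e := β κ + ∑ l ∈ Ico κ n, b l - d with he
  unfold rightRank
  rw [← he]
  have hsplit : ∀ τ, κ + τ ≤ n → ∑ l ∈ Ico κ n, b l =
      τ + ∑ x ∈ Ico κ (κ + τ), (b x - 1) + ∑ x ∈ Ico (κ + τ) n, b x := fun τ hτ => by
    rw [card_le_sum_b h hτ, sum_Ico_consecutive _ (by omega) hτ]
  have hfull : ∀ τ, κ + τ = n → ∑ x ∈ Ico (κ + τ) n, b x = 0 := fun τ hτ => by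
    rw [hτ, Ico_self, sum_empty]
  split_ifs with h1 h2
  · rw [if_pos h1] at hfree
    -- The last left index is free and counts in `free`, so τ wedges are enough. The exponent s is
    -- as large as possible while keeping the left degree at least α κ; τ ≤ e then keeps that degree
    -- below β κ.
    obtain ⟨τ, hτ⟩ : ∃ τ, τ = min (n - κ) e := ⟨_, rfl⟩
    have hs := hsplit τ (by omega)
    have hf := hfull τ
    have := not_van_of_choice (K := K) h (τ := τ)
      (c := d - 1 - ∑ x ∈ Ico (κ + τ) n, b x -
        min (∑ x ∈ Ico κ (κ + τ), (b x - 1)) (d - 1 - ∑ x ∈ Ico (κ + τ) n, b x - α κ))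
      (s := min (∑ x ∈ Ico κ (κ + τ), (b x - 1)) (d - 1 - ∑ x ∈ Ico (κ + τ) n, b x - α κ))
      (by omega) (by omega) (by omega) (by omega) (by omega) (by omega)
    have heq : freeCount κ α β + min (n - κ) e + 1 = free α β κ + τ := by omega
    rwa [heq]
  · rw [if_neg h1] at hfree
    -- The left degree is forced to be β κ, its boundary vanishes, and the missing unit of degree
    -- comes from the right, which allows one wedge more.
    obtain ⟨τ, hτ⟩ : ∃ τ, τ = min (n - κ - 1) e + 1 := ⟨_, rfl⟩
    have hs := hsplit τ (by omega)
    have hf := hfull τ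
    have := not_van_of_choice (K := K) h (τ := τ) (c := β κ)
      (s := d - 1 - ∑ x ∈ Ico (κ + τ) n, b x - β κ)
      (by omega) (by omega) (by omega) (by omega) (by omega) (by omega)
    have heq : freeCount κ α β + min (n - κ - 1) e + 1 = free α β κ + τ := by omega
    rwa [heq]
  · rw [if_neg h1] at hfree
    -- When α κ = β κ = d the right variables play no role, and the class comes from the chain whose
    -- boundary is the left cycle.
    obtain ⟨E, hE, -, hE2⟩ := exists_chain_left (K := K) h κ le_rfl d (by omega) (by omega)
    obtain ⟨E₀, hs, hd⟩ := (hE2 (by omega)).2 h.κ_pos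
    rw [hfree] at hs
    refine not_van_of_chain (E := E₀) le_rfl hκn.le hs ?_ ?_
    · rw [hd]; exact hE.ne
    · rw [hd]; exact hE.mem

end RightPLP

/-! ### Associated primes of right PLP-polymatroidal ideals -/

namespace RightPLP

open Finset MonomialIdeal

variable {n κ d : ℕ} {α β b : ℕ → ℕ}

/-- The exponent vector `v` lies above a basis. -/
def Above (n κ d : ℕ) (α β b v : ℕ → ℕ) : Prop :=
  ∃ u, IsBase n κ d α β b u ∧ ∀ l, l < n → u l ≤ v l

/-- A min-cut criterion: a base below v has sum at most β j before j and at most the sum of v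
afterwards, with right entries also capped by b. Conversely the greedy partial sums attain these
bounds. -/
lemma above_iff (h : Data n κ d α β b) {v : ℕ → ℕ} :
    Above n κ d α β b v ↔
      (∀ j i, j ≤ i → i ≤ κ → α i ≤ β j + ∑ x ∈ Ico j i, v x) ∧
      (∀ j, j ≤ κ → d ≤ β j + ∑ x ∈ Ico j κ, v x + ∑ x ∈ Ico κ n, min (v x) (b x)) := by
  have hκn := h.κ_lt
  constructor
  · rintro ⟨u, hu, hle⟩
    have hI : ∀ j i, i ≤ κ → ∑ x ∈ Ico j i, u x ≤ ∑ x ∈ Ico j i, v x := fun j i hi =>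
      sum_le_sum fun x hx => hle x (by have := mem_Ico.1 hx; omega)
    refine ⟨fun j i hji hi => ?_, fun j hj => ?_⟩
    · have h1 := sum_range_add_sum_Ico u hji
      have := hu.le_sum i hi
      have := hu.sum_le j (by omega)
      have := hI j i hi
      omega
    · have h1 := sum_range_add_sum_Ico u hj
      have h2 := sum_range_add_sum_Ico u hκn.le
      have := hu.sum_le j hj
      have := hI j κ le_rfl
      have h3 : ∑ x ∈ Ico κ n, u x ≤ ∑ x ∈ Ico κ n, min (v x) (b x) :=
        sum_le_sum fun x hx => by
          obtain ⟨h4, h5⟩ := mem_Ico.1 hx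
          exact le_min (hle x h5) (hu.le_b x h4 h5)
      rw [hu.sum_eq] at h2
      omega
  · rintro ⟨h1, h2⟩
    -- Greedy partial sums capped by β. Unrolled back to the last active cap j, s i is the
    -- right-hand side of a cut inequality (`hex`), so the inequalities give its lower bounds.
    let s : ℕ → ℕ := fun i => Nat.rec 0 (fun i r => min (β (i + 1)) (r + v i)) i
    have hs0 : s 0 = 0 := rfl
    have hs : ∀ i, s (i + 1) = min (β (i + 1)) (s i + v i) := fun _ => rfl
    have hex : ∀ i, ∃ j, j ≤ i ∧ s i = β j + ∑ x ∈ Ico j i, v x := fun i => by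
      induction i with
      | zero => exact ⟨0, le_rfl, by simp [hs0, h.β_zero]⟩
      | succ i ih =>
        obtain ⟨j, hj, hsj⟩ := ih
        rcases le_total (β (i + 1)) (s i + v i) with hle | hle
        · exact ⟨i + 1, le_rfl, by rw [hs, min_eq_left hle]; simp⟩
        · refine ⟨j, by omega, ?_⟩
          rw [hs, min_eq_right hle, hsj, sum_Ico_succ_top hj, add_assoc]
    have hsα : ∀ i, i ≤ κ → α i ≤ s i := fun i hi => by
      obtain ⟨j, hj, hsj⟩ := hex i
      rw [hsj]; exact h1 j i hj hi
    have hsβ : ∀ i, s i ≤ β i := fun i => by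
      cases i with
      | zero => exact Nat.zero_le _
      | succ i => rw [hs]; exact min_le_left _ _
    have hsmono : ∀ i, i < κ → s i ≤ s (i + 1) := fun i hi => by
      rw [hs]
      exact le_min ((hsβ i).trans (h.β_mono i (i + 1) (by omega) hi)) (Nat.le_add_right _ _)
    have hsκ : d - s κ ≤ ∑ x ∈ Ico κ n, min (v x) (b x) := by
      obtain ⟨j, hj, hsj⟩ := hex κ
      rw [hsj]
      have := h2 j hj
      omega
    obtain ⟨g, hg, hgs⟩ := exists_le_sum_eq _ _ hsκ
    let u : ℕ → ℕ := fun x => if x < κ then s (x + 1) - s x else g x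
    have husum : ∀ i, i ≤ κ → ∑ x ∈ range i, u x = s i := fun i => by
      induction i with
      | zero => intro _; simp [hs0]
      | succ i ih =>
        intro hi
        rw [sum_range_succ, ih (by omega)]
        have := hsmono i hi
        simp only [u, if_pos (show i < κ by omega)]
        omega
    refine ⟨u, ⟨fun i hi => ?_, fun i hi => ?_, fun l h3 _ => ?_, ?_⟩, fun l _ => ?_⟩
    · rw [husum i hi]; exact hsα i hi
    · rw [husum i hi]; exact hsβ i
    · simp only [u, if_neg (not_lt.2 h3)]
      exact (hg l).trans (min_le_right _ _)
    · rw [← sum_range_add_sum_Ico _ hκn.le, husum κ le_rfl]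
      have h4 : ∑ x ∈ Ico κ n, u x = ∑ x ∈ Ico κ n, g x :=
        sum_congr rfl fun x hx => if_neg (not_lt.2 (mem_Ico.1 hx).1)
      have := (hsβ κ).trans h.β_le
      omega
    · simp only [u]
      split_ifs with hl
      · have := hs l
        have := min_le_right (β (l + 1)) (s l + v l)
        omega
      · exact (hg l).trans (min_le_left _ _)

/-- Increase one coordinate by one. -/
def bump (w : ℕ → ℕ) (l : ℕ) : ℕ → ℕ := fun x => if x = l then w x + 1 else w x

lemma le_bump (w : ℕ → ℕ) (l x : ℕ) : w x ≤ bump w l x := by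
  unfold bump; split_ifs <;> omega

lemma sum_bump (w : ℕ → ℕ) (l : ℕ) (s : Finset ℕ) :
    ∑ x ∈ s, bump w l x = ∑ x ∈ s, w x + if l ∈ s then 1 else 0 := by
  have : ∀ x, bump w l x = w x + if x = l then 1 else 0 := fun x => by
    unfold bump; split_ifs <;> rfl
  simp only [this, sum_add_distrib, sum_ite_eq']

/-- `F` is the support of a monomial prime that annihilates a monomial modulo the ideal. -/
def IsSocle (n κ d : ℕ) (α β b : ℕ → ℕ) (F : Finset ℕ) : Prop :=
  ∃ w, ¬ Above n κ d α β b w ∧ (∀ p, p < n → p ∉ F → d + ∑ x ∈ Ico κ n, b x ≤ w p) ∧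
    ∀ l ∈ F, Above n κ d α β b (bump w l)

/-- The supports of associated primes in the left part. -/
def LeftType (κ : ℕ) (α β : ℕ → ℕ) (F : Finset ℕ) : Prop :=
  ∃ j i, j < i ∧ i ≤ κ ∧ F = Ico j i ∧ β j < α i ∧
    ∀ l, j < l → l < i → α l < β l ∧ β j < β l ∧ α l < α i

/-- The supports of associated primes meeting the right part. -/
def RightType (n κ d : ℕ) (α β b : ℕ → ℕ) (F : Finset ℕ) : Prop :=
  ∃ j, j ≤ κ ∧ ∃ T, T ⊆ Ico κ n ∧ T.Nonempty ∧ F = Ico j κ ∪ T ∧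
    (∀ l, j < l → l ≤ κ → α l < β l ∧ β j < β l) ∧
    β j + ∑ x ∈ Ico κ n \ T, b x < d ∧ α κ + ∑ x ∈ Ico κ n \ T, b x < d ∧
    (j < κ → T.card + d ≤ β κ + ∑ x ∈ Ico κ n, b x) ∧
    T.card + d ≤ β κ + ∑ x ∈ Ico κ n, b x + 1

lemma b_le_sum {x : ℕ} (hx : x ∈ Ico κ n) : b x ≤ ∑ x ∈ Ico κ n, b x :=
  single_le_sum (f := b) (fun _ _ => Nat.zero_le _) hx

/-- Take an inequality of `above_iff` violated by w. Every l in F must enter it, since raising l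
repairs it; no left variable outside F enters it, since exponents there are huge, while right
variables outside F contribute their cap b. So F is read off from the inequality. -/
lemma IsSocle.leftType_or_rightType (h : Data n κ d α β b) {F : Finset ℕ} (hF : F ⊆ range n)
    (hs : IsSocle n κ d α β b F) : LeftType κ α β F ∨ RightType n κ d α β b F := by
  obtain ⟨w, hw, hbig, hsoc⟩ := hs
  have hκn := h.κ_lt
  have hsoc1 : ∀ l ∈ F, ∀ j i, j ≤ i → i ≤ κ →
      α i ≤ β j + (∑ x ∈ Ico j i, w x + if l ∈ Ico j i then 1 else 0) := fun l hl j i hj hi => by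
    rw [← sum_bump]; exact ((above_iff h).1 (hsoc l hl)).1 j i hj hi
  have hsoc2 : ∀ l ∈ F, ∀ j, j ≤ κ →
      d ≤ β j + (∑ x ∈ Ico j κ, w x + if l ∈ Ico j κ then 1 else 0) +
        ∑ x ∈ Ico κ n, min (bump w l x) (b x) := fun l hl j hj => by
    rw [← sum_bump]; exact ((above_iff h).1 (hsoc l hl)).2 j hj
  have hαd : ∀ i, i ≤ κ → α i ≤ d := fun i hi =>
    (h.α_le i hi).trans ((h.β_mono i κ hi le_rfl).trans h.β_le)
  have hlarge : ∀ j i p, i ≤ κ → p ∈ Ico j i → p ∉ F → d ≤ ∑ x ∈ Ico j i, w x :=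
    fun j i p hi hp hpF => by
      have h1 := hbig p (by have := mem_Ico.1 hp; omega) hpF
      have h2 := single_le_sum (f := w) (fun _ _ => Nat.zero_le _) hp
      omega
  by_cases hA : ∃ j i, j ≤ i ∧ i ≤ κ ∧ β j + ∑ x ∈ Ico j i, w x < α i
  · left
    obtain ⟨j, i, hji, hi, hlt⟩ := hA
    have hji' : j < i := by
      rcases Nat.eq_or_lt_of_le hji with rfl | h1
      · have := h.α_le j hi
        omega
      · exact h1
    have hFeq : F = Ico j i := by
      refine Subset.antisymm (fun l hl => ?_) fun p hp => ?_
      · by_contra hcon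
        have := hsoc1 l hl j i hji hi
        rw [if_neg hcon] at this
        omega
      · by_contra hcon
        have := hlarge j i p hi hp hcon
        have := hαd i hi
        omega
    have hmemF : ∀ l, j ≤ l → l < i → l ∈ F := fun l h1 h2 => hFeq ▸ mem_Ico.2 ⟨h1, h2⟩
    -- Raising l leaves the interval [j, l) unchanged and raising j leaves [l, i) unchanged, so w
    -- itself satisfies both inequalities. Subtracting them from the violated one gives the strict
    -- conditions at l.
    refine ⟨j, i, hji', hi, hFeq, by omega, fun l h1 h2 => ?_⟩
    have e1 := hsoc1 l (hmemF l h1.le h2) j l h1.le (by omega)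
    rw [if_neg (by simp)] at e1
    have e2 := hsoc1 j (hmemF j le_rfl hji') l i h2.le hi
    rw [if_neg (by simp; omega)] at e2
    have e3 := sum_Ico_consecutive w h1.le h2.le
    omega
  · push Not at hA
    right
    obtain ⟨j, hj, hlt⟩ : ∃ j, j ≤ κ ∧
        β j + ∑ x ∈ Ico j κ, w x + ∑ x ∈ Ico κ n, min (w x) (b x) < d := by
      by_contra! hcon
      exact hw ((above_iff h).2 ⟨hA, hcon⟩)
    have hminbig : ∀ x ∈ Ico κ n, x ∉ F → min (w x) (b x) = b x := fun x hx hxF => by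
      have h1 := hbig x (mem_Ico.1 hx).2 hxF
      have h2 := b_le_sum (b := b) hx
      omega
    set T := F.filter (κ ≤ ·) with hT
    have hTsub : T ⊆ Ico κ n := fun x hx => by
      obtain ⟨h1, h2⟩ := mem_filter.1 hx
      exact mem_Ico.2 ⟨h2, mem_range.1 (hF h1)⟩
    have hnotT : ∀ x ∈ Ico κ n \ T, min (w x) (b x) = b x := fun x hx => by
      obtain ⟨h1, h2⟩ := mem_sdiff.1 hx
      exact hminbig x h1 fun h3 => h2 (mem_filter.2 ⟨h3, (mem_Ico.1 h1).1⟩)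
    have hsplit : ∀ f : ℕ → ℕ, ∑ x ∈ Ico κ n, f x = ∑ x ∈ Ico κ n \ T, f x + ∑ x ∈ T, f x :=
      fun f => (sum_sdiff hTsub).symm
    have hTlt : ∀ t ∈ T, w t < b t := fun t ht => by
      by_contra hcon
      have h1 := hsoc2 t (mem_filter.1 ht).1 j hj
      rw [if_neg (by have := (mem_filter.1 ht).2; simp; omega)] at h1
      have h2 : ∑ x ∈ Ico κ n, min (bump w t x) (b x) = ∑ x ∈ Ico κ n, min (w x) (b x) :=
        sum_congr rfl fun x _ => by
          unfold bump
          split_ifs with hx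
          · subst hx; omega
          · rfl
      omega
    have hcw : ∑ x ∈ Ico κ n, min (w x) (b x) = ∑ x ∈ Ico κ n \ T, b x + ∑ x ∈ T, w x := by
      rw [hsplit]
      congr 1
      · exact sum_congr rfl hnotT
      · exact sum_congr rfl fun x hx => min_eq_left (hTlt x hx).le
    have hTb : T.card + ∑ x ∈ T, w x ≤ ∑ x ∈ T, b x := by
      rw [card_eq_sum_ones, ← sum_add_distrib]
      exact sum_le_sum fun x hx => by have := hTlt x hx; omega
    have hBsplit := hsplit b
    have hTne : T.Nonempty := by
      rw [nonempty_iff_ne_empty]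
      intro hTe
      rw [hTe, sdiff_empty, sum_empty] at hcw
      have := hA j κ hj le_rfl
      have := h.d_le
      omega
    have hsubF : Ico j κ ⊆ F := fun p hp => by
      by_contra hcon
      have := hlarge j κ p le_rfl hp hcon
      omega
    have hFeq : F = Ico j κ ∪ T := by
      refine Subset.antisymm (fun l hl => ?_) (union_subset hsubF (filter_subset _ _))
      by_contra hcon
      rw [mem_union, not_or] at hcon
      have hlκ : l < κ := by
        by_contra h1
        exact hcon.2 (mem_filter.2 ⟨hl, not_lt.1 h1⟩)
      have h1 := hsoc2 l hl j hj
      rw [if_neg hcon.1] at h1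
      have h2 : ∑ x ∈ Ico κ n, min (bump w l x) (b x) = ∑ x ∈ Ico κ n, min (w x) (b x) :=
        sum_congr rfl fun x hx => by
          unfold bump
          rw [if_neg (by have := (mem_Ico.1 hx).1; omega)]
      omega
    have hmid : ∀ l, j < l → l ≤ κ → β j + ∑ x ∈ Ico j l, w x < β l := fun l h1 h2 => by
      have e1 := hsoc2 j (hsubF (mem_Ico.2 ⟨le_rfl, by omega⟩)) l h2
      rw [if_neg (by simp; omega)] at e1
      have e2 : ∑ x ∈ Ico κ n, min (bump w j x) (b x) = ∑ x ∈ Ico κ n, min (w x) (b x) :=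
        sum_congr rfl fun x hx => by
          unfold bump
          rw [if_neg (by have := (mem_Ico.1 hx).1; omega)]
      have e3 := sum_Ico_consecutive w h1.le h2
      omega
    -- A single unit repairs the violated inequality, so it fails by exactly one.
    have heq : d ≤ β j + ∑ x ∈ Ico j κ, w x + ∑ x ∈ Ico κ n, min (w x) (b x) + 1 := by
      obtain ⟨t, ht⟩ := hTne
      have h1 := hsoc2 t (mem_filter.1 ht).1 j hj
      rw [if_neg (by have := (mem_filter.1 ht).2; simp; omega)] at h1
      have h2 : ∑ x ∈ Ico κ n, min (bump w t x) (b x) ≤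
          ∑ x ∈ Ico κ n, (min (w x) (b x) + if x = t then 1 else 0) :=
        sum_le_sum fun x _ => by unfold bump; split_ifs <;> omega
      rw [sum_add_distrib, sum_ite_eq', if_pos (hTsub ht)] at h2
      omega
    have hακ := hA j κ hj le_rfl
    refine ⟨j, hj, T, hTsub, hTne, hFeq, fun l h1 h2 => ?_, by omega, by omega, fun hjκ => ?_, ?_⟩
    · have e1 := hA j l h1.le h2
      have e2 := hmid l h1 h2
      omega
    · have := hmid κ hjκ le_rfl
      omega
    · rcases Nat.eq_or_lt_of_le hj with rfl | hjκ
      · rw [Ico_self, sum_empty] at heq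
        omega
      · have := hmid κ hjκ le_rfl
        omega

lemma add_sum_Ico_sub {W w : ℕ → ℕ} {j i : ℕ} (hmono : ∀ l, j ≤ l → l < i → W l ≤ W (l + 1))
    (hw : ∀ l, j ≤ l → l < i → w l = W (l + 1) - W l) (a c : ℕ) (hja : j ≤ a) (hac : a ≤ c)
    (hci : c ≤ i) : W a + ∑ x ∈ Ico a c, w x = W c := by
  induction c, hac using Nat.le_induction with
  | base => simp
  | succ c hac ih =>
    rw [sum_Ico_succ_top hac, ← add_assoc, ih (by omega), hw c (by omega) (by omega)]
    have := hmono c (by omega) (by omega)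
    omega

/-- The witness makes the inequality of [j, i) fail by one and keeps the inequalities on smaller
intervals correct up to the unit supplied by the raised variable. -/
lemma LeftType.isSocle (h : Data n κ d α β b) {F : Finset ℕ} (hF : LeftType κ α β F) :
    IsSocle n κ d α β b F := by
  obtain ⟨j, i, hji, hi, rfl, hβα, hmid⟩ := hF
  have hκn := h.κ_lt
  have hjle := h.α_le j (by omega)
  set B := ∑ x ∈ Ico κ n, b x
  -- W l is β j plus the sum of w over [j, l): the least profile compatible with α and starting at β
  -- j, ending one short of α i.
  let W : ℕ → ℕ := fun l => if l = i then α i - 1 else max (α l) (β j)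
  let w : ℕ → ℕ := fun x => if x ∈ Ico j i then W (x + 1) - W x else d + B
  have hWj : W j = β j := by
    simp only [W, if_neg hji.ne]; exact max_eq_right hjle
  have hWi : W i = α i - 1 := if_pos rfl
  have hWl : ∀ l, l ≠ i → W l = max (α l) (β j) := fun l hl => if_neg hl
  have hmono : ∀ l, j ≤ l → l < i → W l ≤ W (l + 1) := fun l h1 h2 => by
    rw [hWl l h2.ne]
    have h3 : α l ≤ α (l + 1) := h.α_mono _ _ (by omega) (by omega)
    by_cases h4 : l + 1 = i
    · rw [h4, hWi]
      rcases Nat.eq_or_lt_of_le h1 with rfl | h5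
      · omega
      · have := (hmid l h5 h2).2.2
        omega
    · rw [hWl _ h4]
      omega
  have hsum := add_sum_Ico_sub hmono (w := w) fun l h1 h2 => if_pos (mem_Ico.2 ⟨h1, h2⟩)
  have hαd : ∀ i, i ≤ κ → α i ≤ d := fun i hi =>
    (h.α_le i hi).trans ((h.β_mono i κ hi le_rfl).trans h.β_le)
  have hfull := hsum j i le_rfl hji.le le_rfl
  refine ⟨w, fun hcon => ?_, fun p hp hpF => ?_, fun l hl => ?_⟩
  · have := ((above_iff h).1 hcon).1 j i hji.le hi
    omega
  · simp only [w, if_neg hpF]; exact le_rfl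
  · have hfirst : ∀ j' i', j' ≤ i' → i' ≤ κ → α i' ≤ β j' + ∑ x ∈ Ico j' i', bump w l x := by
      intro j' i' hji' hi'
      rw [sum_bump]
      by_cases hsub : ∃ p ∈ Ico j' i', p ∉ Ico j i
      · obtain ⟨p, hp, hpF⟩ := hsub
        have h1 := single_le_sum (f := w) (fun _ _ => Nat.zero_le _) hp
        simp only [w] at h1
        rw [if_neg hpF] at h1
        have := hαd i' hi'
        simp only [w]
        omega
      · push Not at hsub
        rcases Nat.eq_or_lt_of_le hji' with rfl | hlt
        · have := h.α_le j' hi'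
          omega
        have e1 := mem_Ico.1 (hsub j' (mem_Ico.2 ⟨le_rfl, hlt⟩))
        have e2 := mem_Ico.1 (hsub (i' - 1) (mem_Ico.2 ⟨by omega, by omega⟩))
        have e3 := hsum j' i' e1.1 hji' (by omega)
        have e4 : α i' ≤ W i' + 1 := by
          by_cases h5 : i' = i
          · rw [h5, hWi]; omega
          · rw [hWl _ h5]; omega
        rcases Nat.eq_or_lt_of_le e1.1 with rfl | hjj
        · by_cases h5 : i' = i
          · subst h5
            rw [if_pos hl]
            omega
          · rw [hWl _ h5, hWj] at e3
            omega
        · have h6 := hmid j' hjj e1.2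
          rw [hWl j' (by omega)] at e3
          omega
    refine (above_iff h).2 ⟨hfirst, fun j' hj' => ?_⟩
    have h1 := hfirst j' κ hj' le_rfl
    have h2 : ∑ x ∈ Ico κ n, min (bump w l x) (b x) = B := sum_congr rfl fun x hx => by
      have h3 := le_bump w l x
      have h4 : w x = d + B := if_neg (by have := mem_Ico.1 hx; simp; omega)
      have h5 := b_le_sum (b := b) hx
      exact min_eq_right (by omega)
    have := h.d_le
    omega

lemma RightType.isSocle (h : Data n κ d α β b) {F : Finset ℕ} (hF : RightType n κ d α β b F) :
    IsSocle n κ d α β b F := by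
  obtain ⟨j, hj, T, hTsub, hTne, rfl, hmid, hβd, hαd', hcard1, hcard2⟩ := hF
  have hκn := h.κ_lt
  have hjle := h.α_le j hj
  have hακ := h.α_le κ le_rfl
  have hBsplit : ∑ x ∈ Ico κ n, b x = ∑ x ∈ Ico κ n \ T, b x + ∑ x ∈ T, b x :=
    (sum_sdiff hTsub).symm
  have hTb : T.card + ∑ x ∈ T, (b x - 1) = ∑ x ∈ T, b x := by
    rw [card_eq_sum_ones, ← sum_add_distrib]
    refine sum_congr rfl fun x hx => ?_
    obtain ⟨h1, h2⟩ := mem_Ico.1 (hTsub hx)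
    have := h.b_pos x h1 h2
    omega
  set B := ∑ x ∈ Ico κ n, b x with hB
  set C := ∑ x ∈ Ico κ n \ T, b x
  -- c is the end of the left profile and s the total on T. Taking s maximal with c still at least α
  -- κ and β j, the two bounds on |T| say precisely that c < β κ is reached when j < κ, and c = β κ
  -- when j = κ.
  obtain ⟨c, s, hs, hcα, hcβ, hcκ, hcj, hsum⟩ : ∃ c s, s ≤ ∑ x ∈ T, (b x - 1) ∧ α κ ≤ c ∧ β j ≤ c ∧
      (j < κ → c < β κ) ∧ (j = κ → c = β κ) ∧ c + s + C + 1 = d := by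
    refine ⟨d - 1 - C - min (∑ x ∈ T, (b x - 1)) (d - 1 - C - max (α κ) (β j)),
      min (∑ x ∈ T, (b x - 1)) (d - 1 - C - max (α κ) (β j)), by omega, by omega, by omega,
      fun hjκ => ?_, fun hjκ => ?_, by omega⟩
    · have := hmid κ hjκ le_rfl
      have := hcard1 hjκ
      omega
    · subst hjκ
      omega
  obtain ⟨g, hg, hgs⟩ := exists_le_sum_eq _ _ hs
  have hglt : ∀ t ∈ T, g t < b t := fun t ht => by
    obtain ⟨h1, h2⟩ := mem_Ico.1 (hTsub ht)
    have := h.b_pos t h1 h2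
    have := hg t
    omega
  let W : ℕ → ℕ := fun l => if l = κ then c else max (α l) (β j)
  let w : ℕ → ℕ := fun x =>
    if x ∈ Ico j κ then W (x + 1) - W x else if x ∈ T then g x else d + B
  have hWκ : W κ = c := if_pos rfl
  have hWl : ∀ l, l ≠ κ → W l = max (α l) (β j) := fun l hl => if_neg hl
  have hWj : W j = β j := by
    rcases Nat.eq_or_lt_of_le hj with hjκ | hjκ
    · rw [hjκ, hWκ, hcj hjκ]
    · rw [hWl j hjκ.ne]; exact max_eq_right hjle
  have hWα : ∀ l, j ≤ l → l ≤ κ → α l ≤ W l := fun l _ _ => by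
    by_cases hlκ : l = κ
    · rw [hlκ, hWκ]; exact hcα
    · rw [hWl l hlκ]; exact le_max_left _ _
  have hWβ : ∀ l, j < l → l ≤ κ → W l < β l := fun l h1 h2 => by
    by_cases hlκ : l = κ
    · rw [hlκ, hWκ]; exact hcκ (by omega)
    · rw [hWl l hlκ]
      have := hmid l h1 h2
      omega
  have hmono : ∀ l, j ≤ l → l < κ → W l ≤ W (l + 1) := fun l h1 h2 => by
    rw [hWl l h2.ne]
    have h3 : α l ≤ α (l + 1) := h.α_mono _ _ (by omega) (by omega)
    by_cases h4 : l + 1 = κ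
    · rw [h4, hWκ]
      rw [h4] at h3
      omega
    · rw [hWl _ h4]
      omega
  have hsumI := add_sum_Ico_sub hmono (w := w) fun l h1 h2 => if_pos (mem_Ico.2 ⟨h1, h2⟩)
  have hαd : ∀ i, i ≤ κ → α i ≤ d := fun i hi =>
    (h.α_le i hi).trans ((h.β_mono i κ hi le_rfl).trans h.β_le)
  have hfull := hsumI j κ le_rfl hj le_rfl
  have hwT : ∀ t ∈ T, w t = g t := fun t ht => by
    have := mem_Ico.1 (hTsub ht)
    simp only [w]
    rw [if_neg (by simp; omega), if_pos ht]
  have hwout : ∀ p, p ∉ Ico j κ ∪ T → w p = d + B := fun p hp => by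
    rw [mem_union, not_or] at hp
    simp only [w]
    rw [if_neg hp.1, if_neg hp.2]
  have hcw : ∑ x ∈ Ico κ n, min (w x) (b x) = C + s := by
    rw [← sum_sdiff hTsub, ← hgs]
    congr 1
    · refine sum_congr rfl fun x hx => ?_
      obtain ⟨h1, h2⟩ := mem_sdiff.1 hx
      rw [hwout x (by
        rw [mem_union, not_or]
        exact ⟨by have := mem_Ico.1 h1; simp; omega, h2⟩)]
      have := b_le_sum (b := b) h1
      exact min_eq_right (by omega)
    · refine sum_congr rfl fun x hx => ?_
      rw [hwT x hx]
      exact min_eq_left (hglt x hx).le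
  refine ⟨w, fun hcon => ?_, fun p _ hpF => (hwout p hpF).ge, fun l hl => ?_⟩
  · have := ((above_iff h).1 hcon).2 j hj
    omega
  have hbig : ∀ j' i' p, p ∈ Ico j' i' → i' ≤ κ → p ∉ Ico j κ → d ≤ ∑ x ∈ Ico j' i', w x :=
    fun j' i' p hp hi' hpF => by
      have h1 := single_le_sum (f := w) (fun _ _ => Nat.zero_le _) hp
      rw [hwout p (by
        rw [mem_union, not_or]
        refine ⟨hpF, fun hpT => ?_⟩
        have := mem_Ico.1 (hTsub hpT)
        have := mem_Ico.1 hp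
        omega)] at h1
      omega
  refine (above_iff h).2 ⟨fun j' i' hji' hi' => ?_, fun j' hj' => ?_⟩
  · rw [sum_bump]
    rcases Nat.eq_or_lt_of_le hji' with rfl | hlt
    · have := h.α_le j' hi'
      omega
    by_cases hjj : j ≤ j'
    · have e1 := hsumI j' i' hjj hji' hi'
      have e2 := hWα i' (by omega) hi'
      rcases Nat.eq_or_lt_of_le hjj with rfl | hjj'
      · omega
      · have := hWβ j' hjj' (by omega)
        omega
    · have := hbig j' i' j' (mem_Ico.2 ⟨le_rfl, hlt⟩) hi' (by simp; omega)
      have := hαd i' hi'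
      omega
  · rw [sum_bump]
    have hle : ∑ x ∈ Ico κ n, min (w x) (b x) ≤ ∑ x ∈ Ico κ n, min (bump w l x) (b x) :=
      sum_le_sum fun x _ => min_le_min_right _ (le_bump w l x)
    by_cases hjj : j ≤ j'
    · have e1 := hsumI j' κ hjj hj' le_rfl
      rcases mem_union.1 hl with hl | hl
      · rcases Nat.eq_or_lt_of_le hjj with rfl | hjj'
        · rw [if_pos hl]
          omega
        · have := hWβ j' hjj' hj'
          omega
      · have hlt : ∑ x ∈ Ico κ n, min (w x) (b x) < ∑ x ∈ Ico κ n, min (bump w l x) (b x) := by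
          refine sum_lt_sum (fun x _ => min_le_min_right _ (le_bump w l x)) ⟨l, hTsub hl, ?_⟩
          have h1 : bump w l l = w l + 1 := if_pos rfl
          have := hglt l hl
          rw [h1, hwT l hl]
          omega
        have e2 : W j' ≤ β j' := by
          rcases Nat.eq_or_lt_of_le hjj with rfl | hjj'
          · exact hWj.le
          · exact (hWβ j' hjj' hj').le
        omega
    · have := hbig j' κ j' (mem_Ico.2 ⟨le_rfl, by omega⟩) le_rfl (by simp; omega)
      omega

/-- The supports of the associated primes. -/
theorem isSocle_iff (h : Data n κ d α β b) {F : Finset ℕ} (hF : F ⊆ range n) :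
    IsSocle n κ d α β b F ↔ LeftType κ α β F ∨ RightType n κ d α β b F :=
  ⟨fun hs => hs.leftType_or_rightType h hF, fun hs => hs.elim (·.isSocle h) (·.isSocle h)⟩

lemma above_ext_iff (hκ : κ < n) {w : Fin n →₀ ℕ} :
    (∃ u ∈ baseSet n κ d α β b, u ≤ w) ↔ Above n κ d α β b (ext w) := by
  constructor
  · rintro ⟨u, hu, hle⟩
    refine ⟨ext u, hu, fun l hl => ?_⟩
    rw [ext_of_lt _ hl, ext_of_lt _ hl]
    exact hle _
  · rintro ⟨u, hu, hle⟩
    refine ⟨expo n u, (expo_mem_baseSet hκ).2 hu, fun i => ?_⟩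
    rw [expo_apply, ← ext_apply w i]
    exact hle i i.2

lemma Above.congr {v v' : ℕ → ℕ} (h : ∀ l, l < n → v l = v' l) (hv : Above n κ d α β b v) :
    Above n κ d α β b v' := by
  obtain ⟨u, hu, hle⟩ := hv
  exact ⟨u, hu, fun l hl => h l hl ▸ hle l hl⟩

/-- The associated primes of a right PLP-polymatroidal ideal. -/
theorem mem_associatedPrimes_iff_type {K : Type*} [Field K] (h : Data n κ d α β b)
    {P : Ideal (MvPolynomial (Fin n) K)} :
    P ∈ associatedPrimes (MvPolynomial (Fin n) K)
        (MvPolynomial (Fin n) K ⧸ spanMon K (baseSet n κ d α β b)) ↔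
      ∃ F : Finset ℕ, F ⊆ range n ∧ P = varIdeal K {i : Fin n | (i : ℕ) ∈ F} ∧
        (LeftType κ α β F ∨ RightType n κ d α β b F) := by
  classical
  have hκn := h.κ_lt
  rw [mem_associatedPrimes_iff (D := d + ∑ x ∈ Ico κ n, b x)
    fun u hu i => (apply_le_of_mem_baseSet hu i).trans (Nat.le_add_right _ _)]
  constructor
  · rintro ⟨F, rfl, w, h1, h2, h3⟩
    let F' : Finset ℕ := (univ.filter (· ∈ F)).map Fin.valEmbedding
    have hF' : ∀ i : Fin n, (i : ℕ) ∈ F' ↔ i ∈ F := fun i => by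
      simp [F', Fin.val_inj]
    have hsub : F' ⊆ range n := fun x hx => by
      obtain ⟨i, -, rfl⟩ := mem_map.1 hx
      exact mem_range.2 i.2
    refine ⟨F', hsub, ?_, (isSocle_iff h hsub).1 ⟨ext w, ?_, fun p hp hpF => ?_, fun l hl => ?_⟩⟩
    · congr 1
      ext i
      exact (hF' i).symm
    · rwa [← above_ext_iff hκn]
    · rw [ext_of_lt _ hp]
      exact h2 _ fun hcon => hpF ((hF' ⟨p, hp⟩).2 hcon)
    · have hln := mem_range.1 (hsub hl)
      have := h3 ⟨l, hln⟩ ((hF' ⟨l, hln⟩).1 hl)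
      rw [above_ext_iff hκn] at this
      refine this.congr fun x hx => ?_
      rw [ext_add, ext_single, bump]
      split_ifs <;> simp
  · rintro ⟨F, hsub, rfl, htype⟩
    obtain ⟨w, h1, h2, h3⟩ := (isSocle_iff h hsub).2 htype
    refine ⟨_, rfl, expo n w, fun hcon => h1 ?_, fun p hp => ?_, fun l hl => ?_⟩
    · rw [above_ext_iff hκn] at hcon
      exact hcon.congr fun l hl => ext_expo w hl
    · rw [expo_apply]
      exact h2 p p.2 hp
    · rw [above_ext_iff hκn]
      refine (h3 l hl).congr fun x hx => ?_
      rw [ext_add, ext_single, bump, ext_expo w hx]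
      split_ifs <;> simp

end RightPLP

/-! ### Stability indices -/

namespace RightPLP

open Finset MonomialIdeal

variable {n κ d : ℕ} {α β b : ℕ → ℕ}

/-- The threshold governing stability. -/
def threshold (n κ : ℕ) (α β : ℕ → ℕ) : ℕ := if α κ < β κ then n - κ else n - κ - 1

lemma LeftType.scale {m : ℕ} (hm : 0 < m) {F : Finset ℕ} :
    LeftType κ (fun i => m * α i) (fun i => m * β i) F ↔ LeftType κ α β F := by
  simp only [LeftType, Nat.mul_lt_mul_left hm]

/-- Apart from the two bounds on |T|, all conditions are homogeneous in m. For scale l those bounds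
read |T| ≤ l·e and |T| ≤ l·e + 1. They are automatic once l·e reaches the threshold, as |T| ≤ n − κ
and the first one occurs only if α κ < β κ; for e = 0 they do not depend on l. -/
lemma RightType.of_scale (h : Data n κ d α β b) {e : ℕ} (he : d + e = β κ + ∑ x ∈ Ico κ n, b x)
    {m l : ℕ} (hm : 0 < m) (hl : 0 < l) (hcond : e = 0 ∨ threshold n κ α β ≤ l * e)
    {F : Finset ℕ}
    (hF : RightType n κ (m * d) (fun i => m * α i) (fun i => m * β i) (fun i => m * b i) F) :
    RightType n κ (l * d) (fun i => l * α i) (fun i => l * β i) (fun i => l * b i) F := by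
  have hβ := h.α_le κ le_rfl
  obtain ⟨j, hj, T, hTsub, hTne, hFeq, hmid, h1, h2, h3, h4⟩ := hF
  have hTc : T.card ≤ n - κ := by
    have := card_le_card hTsub
    rwa [Nat.card_Ico] at this
  have hsc : ∀ a, a * d + a * e = a * β κ + a * ∑ x ∈ Ico κ n, b x := fun a => by
    rw [← mul_add, he, mul_add]
  have hem := hsc m
  have hel := hsc l
  simp only [← mul_sum, ← mul_add, Nat.mul_lt_mul_left hm] at hmid h1 h2 h3 h4
  unfold threshold at hcond
  refine ⟨j, hj, T, hTsub, hTne, hFeq, ?_, ?_, ?_, ?_, ?_⟩ <;>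
    simp only [← mul_sum, ← mul_add, Nat.mul_lt_mul_left hl]
  · exact hmid
  · exact h1
  · exact h2
  · intro hjκ
    have h5 := (hmid κ hjκ le_rfl).1
    rw [if_pos h5] at hcond
    have h6 := h3 hjκ
    rw [mul_add] at h6 ⊢
    rcases hcond with rfl | hcond
    · omega
    · omega
  · rw [mul_add] at h4 ⊢
    rcases hcond with rfl | hcond
    · omega
    · split_ifs at hcond <;> omega

theorem associatedPrimes_eq {K : Type*} [Field K] (h : Data n κ d α β b) {e : ℕ}
    (he : d + e = β κ + ∑ x ∈ Ico κ n, b x) {m l : ℕ} (hm : 0 < m) (hml : m ≤ l)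
    (hcond : e = 0 ∨ threshold n κ α β ≤ m * e) :
    associatedPrimes (MvPolynomial (Fin n) K)
        (MvPolynomial (Fin n) K ⧸ spanMon K (baseSet n κ d α β b) ^ m) =
      associatedPrimes (MvPolynomial (Fin n) K)
        (MvPolynomial (Fin n) K ⧸ spanMon K (baseSet n κ d α β b) ^ l) := by
  have hl : 0 < l := by omega
  have hcond' : e = 0 ∨ threshold n κ α β ≤ l * e :=
    hcond.imp_right fun h1 => h1.trans (Nat.mul_le_mul_right _ hml)
  obtain ⟨m, rfl⟩ : ∃ m', m = m' + 1 := ⟨m - 1, by omega⟩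
  obtain ⟨l, rfl⟩ : ∃ l', l = l' + 1 := ⟨l - 1, by omega⟩
  ext P
  rw [spanMon_pow h.κ_lt, spanMon_pow h.κ_lt, mem_associatedPrimes_iff_type (h.scale hm),
    mem_associatedPrimes_iff_type (h.scale hl)]
  refine exists_congr fun F => and_congr_right fun _ => and_congr_right fun _ => or_congr ?_ ?_
  · rw [LeftType.scale hm, LeftType.scale hl]
  · exact ⟨.of_scale h he hm hl hcond', .of_scale h he hl hm hcond⟩

/-- The prime that appears last contains all right variables, which makes |T| = n − κ as large as
possible. The final two clauses record that its bounds on |T| fail at the exponent m. -/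
lemma exists_rightType (h : Data n κ d α β b) {e : ℕ} (he : d + e = β κ + ∑ x ∈ Ico κ n, b x)
    {m l : ℕ} (hl : 0 < l) (hme : m * e < threshold n κ α β)
    (hle : threshold n κ α β ≤ l * e) (hm : 0 < m) :
    ∃ j, j ≤ κ ∧
      RightType n κ (l * d) (fun i => l * α i) (fun i => l * β i) (fun i => l * b i)
        (Ico j κ ∪ Ico κ n) ∧
      (j < κ → m * e < n - κ) ∧ (j = κ → m * e + 1 < n - κ) := by
  have hκn := h.κ_lt
  have hαβ := h.α_le κ le_rfl
  have hβd := h.β_le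
  have hel : l * d + l * e = l * β κ + l * ∑ x ∈ Ico κ n, b x := by
    rw [← mul_add, he, mul_add]
  have hcard : (Ico κ n).card = n - κ := Nat.card_Ico _ _
  have hne : (Ico κ n).Nonempty := nonempty_Ico.2 hκn
  unfold threshold at hme hle
  split_ifs at hme hle with hlt
  · classical
    -- The last index with β j < β κ: all later β equal β κ, which exceeds every α.
    obtain ⟨j, hj1, hj2, hj3⟩ : ∃ j, j < κ ∧ β j < β κ ∧ ∀ i, j < i → i ≤ κ → β i = β κ := by
      have h0 : β 0 < β κ := by
        rw [h.β_zero]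
        exact h.β_one.trans_le (h.β_mono 1 κ h.κ_pos le_rfl)
      let j := Nat.findGreatest (fun j => β j < β κ) κ
      have hspec : β j < β κ := Nat.findGreatest_spec (P := fun j => β j < β κ) (Nat.zero_le κ) h0
      have hle' : j ≤ κ := Nat.findGreatest_le κ
      have hne' : j ≠ κ := fun h1 => by rw [h1] at hspec; exact lt_irrefl _ hspec
      refine ⟨j, by omega, hspec, fun i h1 h2 => ?_⟩
      have h3 := Nat.findGreatest_is_greatest (P := fun j => β j < β κ) h1 h2
      have h4 := h.β_mono i κ h2 le_rfl
      omega
    refine ⟨j, hj1.le, ⟨j, hj1.le, Ico κ n, subset_rfl, hne, rfl, fun i h1 h2 => ?_, ?_, ?_,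
      fun _ => ?_, ?_⟩, fun _ => hme, fun h1 => by omega⟩
    · have h3 := h.α_mono i κ h2 le_rfl
      have h4 := hj3 i h1 h2
      exact ⟨Nat.mul_lt_mul_of_pos_left (by omega) hl, Nat.mul_lt_mul_of_pos_left (by omega) hl⟩
    · simpa using Nat.mul_lt_mul_of_pos_left (show β j < d by omega) hl
    · simpa using Nat.mul_lt_mul_of_pos_left (show α κ < d by omega) hl
    · rw [hcard, ← mul_sum]; beta_reduce; omega
    · rw [hcard, ← mul_sum]; beta_reduce; omega
  · have hsum : n - κ ≤ ∑ x ∈ Ico κ n, b x := by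
      rw [← hcard, card_eq_sum_ones]
      exact sum_le_sum fun x hx => h.b_pos x (mem_Ico.1 hx).1 (mem_Ico.1 hx).2
    -- Otherwise β κ = d and e is the whole right capacity, at least n − κ, which contradicts `hme`.
    have hβlt : β κ < d := by
      by_contra hcon
      have h1 : e ≤ m * e := Nat.le_mul_of_pos_left _ hm
      omega
    refine ⟨κ, le_rfl, ⟨κ, le_rfl, Ico κ n, subset_rfl, hne, rfl, fun i h1 h2 => by omega, ?_, ?_,
      fun h1 => by omega, ?_⟩, fun h1 => by omega, fun _ => by omega⟩
    · simpa using Nat.mul_lt_mul_of_pos_left hβlt hl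
    · simpa using Nat.mul_lt_mul_of_pos_left (show α κ < d by omega) hl
    · rw [hcard, ← mul_sum]; beta_reduce; omega

theorem associatedPrimes_ne {K : Type*} [Field K] (h : Data n κ d α β b) {e : ℕ}
    (he : d + e = β κ + ∑ x ∈ Ico κ n, b x) {m l : ℕ} (hm : 0 < m) (hml : m ≤ l)
    (hme : m * e < threshold n κ α β) (hle : threshold n κ α β ≤ l * e) :
    associatedPrimes (MvPolynomial (Fin n) K)
        (MvPolynomial (Fin n) K ⧸ spanMon K (baseSet n κ d α β b) ^ m) ≠
      associatedPrimes (MvPolynomial (Fin n) K)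
        (MvPolynomial (Fin n) K ⧸ spanMon K (baseSet n κ d α β b) ^ l) := by
  have hκn := h.κ_lt
  have hl : 0 < l := by omega
  obtain ⟨j, hj, htype, h1, h2⟩ := exists_rightType h he hl hme hle hm
  obtain ⟨m, rfl⟩ : ∃ m', m = m' + 1 := ⟨m - 1, by omega⟩
  obtain ⟨l, rfl⟩ : ∃ l', l = l' + 1 := ⟨l - 1, by omega⟩
  intro heq
  have hsub : Ico j κ ∪ Ico κ n ⊆ range n := fun x hx => by
    rw [mem_union, mem_Ico, mem_Ico] at hx
    exact mem_range.2 (by omega)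
  have hmem := (mem_associatedPrimes_iff_type (K := K) (h.scale hl)).2
    ⟨_, hsub, rfl, Or.inr htype⟩
  rw [← spanMon_pow hκn, ← heq, spanMon_pow hκn, mem_associatedPrimes_iff_type (h.scale hm)] at hmem
  obtain ⟨F, hF, hvar, hor⟩ := hmem
  have hFeq : F = Ico j κ ∪ Ico κ n := by
    have h3 := varIdeal_injective hvar
    ext x
    by_cases hx : x < n
    · have := congrArg (fun s : Set (Fin n) => (⟨x, hx⟩ : Fin n) ∈ s) h3
      simpa [hx] using (iff_of_eq this).symm
    · exact ⟨fun h4 => absurd (mem_range.1 (hF h4)) hx, fun h4 => absurd (mem_range.1 (hsub h4)) hx⟩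
  subst hFeq
  have hem : (m + 1) * d + (m + 1) * e = (m + 1) * β κ + (m + 1) * ∑ x ∈ Ico κ n, b x := by
    rw [← mul_add, he, mul_add]
  -- A left-type support misses n − 1, and a right-type one determines T as its part in [κ, n), so
  -- the failing bounds on |T| cannot be avoided by another presentation.
  rcases hor with ⟨j', i', _, hi', hF', -⟩ | ⟨j', hj', T, hT, -, hF', -, -, -, h5, h6⟩
  · have h3 : n - 1 ∈ Ico j' i' := by
      rw [← hF', mem_union, mem_Ico, mem_Ico]; omega
    have := mem_Ico.1 h3
    omega
  · have hTeq : T = Ico κ n := Subset.antisymm hT fun x hx => by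
      have h3 : x ∈ Ico j' κ ∪ T := hF' ▸ mem_union_right _ hx
      rcases mem_union.1 h3 with h4 | h4
      · have := mem_Ico.1 h4
        have := mem_Ico.1 hx
        omega
      · exact h4
    subst hTeq
    rw [Nat.card_Ico, ← mul_sum] at h5 h6
    beta_reduce at h5 h6
    rcases Nat.eq_or_lt_of_le hj with hjκ | hjκ
    · have := h2 hjκ
      omega
    · have h3 : j ∈ Ico j' κ ∪ Ico κ n := hF' ▸ mem_union_left _ (mem_Ico.2 ⟨le_rfl, hjκ⟩)
      have h4 : j' < κ := by
        rcases mem_union.1 h3 with h4 | h4 <;> have := mem_Ico.1 h4 <;> omega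
      have := h5 h4
      have := h1 hjκ
      omega

/-! ### Depth of the ideal and of its powers -/

theorem depthQuot_of_data {K : Type*} [Field K] (h : Data n κ d α β b) :
    depthQuot (spanMon K (baseSet n κ d α β b)) =
      ((n - (freeCount κ α β + rightRank n κ d α β b + 1) : ℕ) : ℕ∞) := by
  refine depthQuot_eq ?_ (fun i hi => van_of_data h hi) (not_van_of_data h)
  rw [← Set.image_univ]
  intro g hg
  rw [MvPolynomial.mem_ideal_span_X_image]
  intro m hm
  obtain ⟨u, hu, hle⟩ := MvPolynomial.mem_ideal_span_monomial_image.1 hg m hm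
  by_contra! hcon
  have h1 : u = 0 := by
    ext i
    have := hle i
    rw [hcon i (Set.mem_univ _)] at this
    exact Nat.le_zero.1 this
  have h2 := degree_of_mem_baseSet hu
  rw [h1, map_zero] at h2
  exact h.d_pos.ne h2

lemma freeCount_lt (h : Data n κ d α β b) : freeCount κ α β < κ := by
  have h1 := card_filter_le (range (κ - 1)) fun l => α (l + 1) < β (l + 1)
  rw [card_range] at h1
  have := h.κ_pos
  unfold freeCount
  omega

theorem depthQuot_pow {K : Type*} [Field K] (h : Data n κ d α β b) {e : ℕ}
    (he : d + e = β κ + ∑ x ∈ Ico κ n, b x) {m : ℕ} (hm : 0 < m) :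
    depthQuot (spanMon K (baseSet n κ d α β b) ^ m) =
      ((n - (freeCount κ α β + (if α κ = β κ ∧ β κ = d then 0 else
        min (threshold n κ α β) (m * e)) + 1) : ℕ) : ℕ∞) := by
  obtain ⟨m, rfl⟩ : ∃ m', m = m' + 1 := ⟨m - 1, by omega⟩
  have hαβ := h.α_le κ le_rfl
  have hβd := h.β_le
  rw [spanMon_pow h.κ_lt, depthQuot_of_data (h.scale hm)]
  have h1 : freeCount κ (fun i => (m + 1) * α i) (fun i => (m + 1) * β i) = freeCount κ α β := by
    simp only [freeCount, Nat.mul_lt_mul_left hm]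
  have hem : (m + 1) * d + (m + 1) * e = (m + 1) * β κ + (m + 1) * ∑ x ∈ Ico κ n, b x := by
    rw [← mul_add, he, mul_add]
  have h2 : (m + 1) * β κ + (m + 1) * ∑ x ∈ Ico κ n, b x - (m + 1) * d = (m + 1) * e := by omega
  rw [h1]
  simp only [rightRank, threshold, ← mul_sum, h2, Nat.mul_lt_mul_left hm]
  congr 4
  split_ifs <;> first | rfl | omega

theorem depthQuot_pow_eq {K : Type*} [Field K] (h : Data n κ d α β b) {e : ℕ}
    (he : d + e = β κ + ∑ x ∈ Ico κ n, b x) {m l : ℕ} (hm : 0 < m) (hml : m ≤ l)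
    (hcond : e = 0 ∨ threshold n κ α β ≤ m * e) :
    depthQuot (spanMon K (baseSet n κ d α β b) ^ m) =
      depthQuot (spanMon K (baseSet n κ d α β b) ^ l) := by
  rw [depthQuot_pow h he hm, depthQuot_pow h he (by omega : 0 < l)]
  rcases hcond with rfl | hcond
  · simp
  · rw [min_eq_left hcond, min_eq_left (hcond.trans (Nat.mul_le_mul_right _ hml))]

theorem depthQuot_pow_ne {K : Type*} [Field K] (h : Data n κ d α β b) {e : ℕ}
    (he : d + e = β κ + ∑ x ∈ Ico κ n, b x) {m l : ℕ} (hm : 0 < m) (hml : m ≤ l)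
    (hme : m * e < threshold n κ α β) (hle : threshold n κ α β ≤ l * e) :
    depthQuot (spanMon K (baseSet n κ d α β b) ^ m) ≠
      depthQuot (spanMon K (baseSet n κ d α β b) ^ l) := by
  have hκn := h.κ_lt
  have hfree := freeCount_lt h
  rw [depthQuot_pow h he hm, depthQuot_pow h he (by omega : 0 < l), min_eq_right hme.le,
    min_eq_left hle]
  have hthr : threshold n κ α β ≤ n - κ := by unfold threshold; split_ifs <;> omega
  -- In the degenerate case e is at least n − κ, so the threshold is already reached at the first
  -- power.
  have hnot : ¬ (α κ = β κ ∧ β κ = d) := by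
    rintro ⟨h1, h2⟩
    have hsum : n - κ ≤ ∑ x ∈ Ico κ n, b x := by
      rw [← Nat.card_Ico κ n, card_eq_sum_ones]
      exact sum_le_sum fun x hx => h.b_pos x (mem_Ico.1 hx).1 (mem_Ico.1 hx).2
    have : e ≤ m * e := Nat.le_mul_of_pos_left _ hm
    omega
  rw [if_neg hnot, if_neg hnot]
  intro hcon
  have := ENat.natCast_inj.1 hcon
  omega

/-- The common arithmetic of both indices. For e = 0 the convention R / 0 = 0 makes the right-hand
side 1, which is the value needed in that case. -/
lemma sInf_stable_eq {T : Type*} {X : ℕ → T} {e R : ℕ}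
    (heq : ∀ m l, 0 < m → m ≤ l → (e = 0 ∨ R ≤ m * e) → X m = X l)
    (hne : ∀ m l, 0 < m → m ≤ l → m * e < R → R ≤ l * e → X m ≠ X l) :
    sInf {m : ℕ | 1 ≤ m ∧ ∀ l, m ≤ l → X m = X l} = max 1 ⌈(R : ℚ) / (e : ℚ)⌉₊ := by
  have hiff : ∀ m : ℕ, 0 < e → (⌈(R : ℚ) / (e : ℚ)⌉₊ ≤ m ↔ R ≤ m * e) := fun m he => by
    rw [Nat.ceil_le, div_le_iff₀ (by exact_mod_cast he)]
    exact_mod_cast Iff.rfl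
  refine IsLeast.csInf_eq ⟨⟨le_max_left _ _, fun l hl => heq _ _ (by omega) hl ?_⟩, ?_⟩
  · rcases Nat.eq_zero_or_pos e with h0 | he
    · exact Or.inl h0
    · exact Or.inr ((hiff _ he).1 (le_max_right _ _))
  · rintro m ⟨hm, hst⟩
    refine max_le hm ?_
    rcases Nat.eq_zero_or_pos e with h0 | he
    · subst h0; simp
    · rw [hiff m he]
      by_contra hcon
      -- Any exponent beyond the threshold would do for the comparison; m + R is one, as e is
      -- positive.
      refine hne m (m + R) hm (Nat.le_add_right _ _) (not_le.1 hcon) ?_ (hst _ (Nat.le_add_right _ _))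
      calc R ≤ m + R := Nat.le_add_left _ _
        _ ≤ (m + R) * e := Nat.le_mul_of_pos_right _ he

theorem astab_eq {K : Type*} [Field K] (h : Data n κ d α β b) {e : ℕ}
    (he : d + e = β κ + ∑ x ∈ Ico κ n, b x) :
    astab (spanMon K (baseSet n κ d α β b)) = max 1 ⌈(threshold n κ α β : ℚ) / (e : ℚ)⌉₊ :=
  sInf_stable_eq (fun _ _ hm hml hc => associatedPrimes_eq h he hm hml hc)
    fun _ _ hm hml h1 h2 => associatedPrimes_ne h he hm hml h1 h2

theorem dstab_eq {K : Type*} [Field K] (h : Data n κ d α β b) {e : ℕ}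
    (he : d + e = β κ + ∑ x ∈ Ico κ n, b x) :
    dstab (spanMon K (baseSet n κ d α β b)) = max 1 ⌈(threshold n κ α β : ℚ) / (e : ℚ)⌉₊ :=
  sInf_stable_eq (X := fun m => depthQuot (spanMon K (baseSet n κ d α β b) ^ m))
    (fun _ _ hm hml hc => depthQuot_pow_eq h he hm hml hc)
    fun _ _ hm hml h1 h2 => depthQuot_pow_ne h he hm hml h1 h2

end RightPLP

theorem mainTheorem11 {K : Type*} [Field K] {n : ℕ} (I : Ideal (MvPolynomial (Fin n) K))
    (d : ℕ) (k : Fin n) (b α β : Fin n → ℕ) (hI : IsRightPLPIdeal I d k b α β) :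
    (d = β k + ∑ i ∈ Finset.Ioi k, b i → astab I = 1) ∧
    (d < β k + ∑ i ∈ Finset.Ioi k, b i →
      (astab I : ℤ) =
        max 1 ⌈((n : ℚ) - ((k : ℕ) + 1 : ℚ) - (⌊(α k : ℚ) / (β k : ℚ)⌋ : ℚ)) /
          ((β k : ℚ) + ∑ i ∈ Finset.Ioi k, (b i : ℚ) - (d : ℚ))⌉) ∧
    astab I = dstab I := by
  obtain ⟨htype, rfl⟩ := hI
  have hdata := RightPLP.data_of_isRightPLPType htype
  have hk := htype.k_lt
  have hideal : plpIdeal K 0 b α β = MonomialIdeal.spanMon K (RightPLP.baseSet n (k + 1) d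
      (RightPLP.lowerBound d k b α) (RightPLP.shift β) (RightPLP.ext b)) := by
    rw [plpIdeal, RightPLP.plpBases_eq htype]
  obtain ⟨e, he⟩ := Nat.exists_eq_add_of_le htype.d_le
  have he' : d + e = RightPLP.shift β (k + 1) +
      ∑ x ∈ Finset.Ico ((k : ℕ) + 1) n, RightPLP.ext b x := by
    rw [RightPLP.shift_succ, ← RightPLP.sum_Ioi_eq, he]
  have hα : RightPLP.lowerBound d k b α (k + 1) = max (α k) (d - ∑ j ∈ Finset.Ioi k, b j) :=
    if_pos rfl
  rw [hideal, RightPLP.astab_eq hdata he', RightPLP.dstab_eq hdata he']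
  refine ⟨fun hd => ?_, fun hd => ?_, rfl⟩
  · have h0 : e = 0 := by omega
    simp [h0]
  · have hβpos := htype.β_pos k le_rfl
    have hαβ := htype.α_le_β k
    have hden : (β k : ℚ) + ∑ i ∈ Finset.Ioi k, (b i : ℚ) - (d : ℚ) = (e : ℚ) := by
      have : ((β k + ∑ i ∈ Finset.Ioi k, b i : ℕ) : ℚ) = ((d + e : ℕ) : ℚ) := by rw [he]
      push_cast at this
      linarith
    have hnum : (n : ℚ) - ((k : ℕ) + 1 : ℚ) - (⌊(α k : ℚ) / (β k : ℚ)⌋ : ℚ) =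
        (RightPLP.threshold n (k + 1) (RightPLP.lowerBound d k b α) (RightPLP.shift β) : ℚ) := by
      have hβq : (0 : ℚ) < β k := by exact_mod_cast hβpos
      -- Since d < β_k + b([k+1,n]), raising α_k to d − b([k+1,n]) cannot turn α_k < β_k into
      -- equality, so the threshold sees the original α_k. The floor is 1 exactly when α_k = β_k.
      unfold RightPLP.threshold
      rw [hα, RightPLP.shift_succ]
      rcases Nat.lt_or_ge (α k) (β k) with hlt | hge
      · have hfl : ⌊(α k : ℚ) / (β k : ℚ)⌋ = 0 := by
          rw [Int.floor_eq_zero_iff]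
          refine ⟨by positivity, ?_⟩
          rw [div_lt_one hβq]
          exact_mod_cast hlt
        rw [hfl, if_pos (by omega), Nat.cast_sub hk.le]
        push_cast
        ring
      · have heq : α k = β k := le_antisymm hαβ hge
        have hfl : ⌊(α k : ℚ) / (β k : ℚ)⌋ = 1 := by
          rw [heq, div_self hβq.ne', Int.floor_one]
        rw [hfl, if_neg (by omega), Nat.cast_sub (by omega), Nat.cast_sub hk.le]
        push_cast
        ring
    rw [hden, hnum, Nat.cast_max, Int.natCast_ceil_eq_ceil (by positivity), Nat.cast_one]
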